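/- Let $v>0$, $r\ge 0$, $\rho>0$ with $2r\rho\le 1$ (that is, $\rho\in(0,1/(2r)]$, and any $\rho>0$ if $r=0$). An admissible configuration of balls of radius $r$ is a sequence $x=(x_i)_{i\in\mathbb Z}$ of reals with $x_i+r\le x_{i+1}-r$ for all $i$; two such sequences are the same configuration of indistinguishable particles if they differ by a shift of the index. The space of labelled configurations carries the $\sigma$-algebra generated by finite cylinders and the space $\mathcal X_r$ of configurations of indistinguishable particles carries the quotient $\sigma$-algebra. The deterministic traffic map $T=\pi(1,v,r,\mathbb R)$ on $\mathcal X_r$ is induced by $(Tx)_i=\min\{x_i+v,\;x_{i+1}-2r\}$. A configuration has density $\rho$ if $n/(x_{n-1}-x_0)\to\rho$ as $n\to\infty$ for every labelling. Put $d:=\dfrac{v\rho}{1+2(1/2-r/v)v\rho}\in(0,1]$. Then there is a stationary Markov measure $\nu$ on $\{0,1\}^{\mathbb Z}$ with $\nu(b_0=1)=d$ and transition matrix $\begin{pmatrix}1-a&a\\1&0\end{pmatrix}$, $a=d/(1-d)$, if $d\le 1/2$, and $\begin{pmatrix}0&1\\c&1-c\end{pmatrix}$, $c=(1-d)/d$,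 if $d>1/2$, such that the measure $\mu_\rho$ on $\mathcal X_r$ constructed from $\nu$ as follows has properties 1–4 below. Construction. (a) Lift $\nu$ to the $\sigma$-finite measure on labelled configurations of balls of radius $1/2$ on $\mathbb Z$ (the particles being the ones of $b$) in which the label $0$ is given to each particle of $b$ in turn: the lift is the sum over $n\in\mathbb Z$ of the images of $\nu|_{\{b_n=1\}}$ under labelling the ones of $b$ in increasing order with $x_0=n$. (b) Apply the radius change $x_i\mapsto x_i-2i(1/2-r/v)$. (c) Apply $z\mapsto vz+w$ and average over $w$ uniformly distributed in $[0,v)$. (d) Restrict to $\{x_0\le 0<x_1\}$ (one labelling of each configuration), normalize to total mass one, and forget the labels. Properties. 1. $\mu_\rho$ is a $T$-invariant probability measure. 2. $\mu_\rho$ is non-atomic: every measurable set of positive measure contains a measurable subset of strictly smaller positive measure. 3. $\mu_\rho$-almost every configuration has density $\rho$. 4. The expected number of particles per unit length is $\rho$ at all times: for every $t\ge0$ and every Borel set $B\subseteq\mathbb R$, the $\mu_\rho$-expectation of the number of particles of $T^t x$ in $B$, counted with multiplicity, equals $\rho\,|B|$, where $|B|$ is the Lebesgue measure. -/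

import Mathlib

open MeasureTheory Filter Topology

noncomputable section

namespace Traffic

/-! ### Configurations and the deterministic traffic map -/

/-- Admissible labelled configurations of balls of radius `r` on the real line: `x i` is the centre
of the `i`-th ball.  The σ-algebra is the one generated by the finite cylinders. -/
abbrev LabelledConfig (r : ℝ) : Type :=
  {x : ℤ → ℝ // ∀ i, x i + r ≤ x (i + 1) - r}

/-- Two labelled configurations are the same configuration of indistinguishable particles if they
differ by an (order preserving) relabelling of the particles by `ℤ`. -/
def relabelling (r : ℝ) : Setoid (LabelledConfig r) where
  r x y := ∃ k : ℤ, ∀ i, y.1 i = x.1 (i + k)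
  iseqv :=
    { refl := fun x => ⟨0, fun i => by simp⟩
      symm := by
        rintro x y ⟨k, hk⟩
        exact ⟨-k, fun i => by rw [hk]; simp⟩
      trans := by
        rintro x y z ⟨k, hk⟩ ⟨l, hl⟩
        exact ⟨l + k, fun i => by rw [hl, hk, add_assoc]⟩ }

/-- Configurations of indistinguishable particles (with multiplicities if `r = 0`).  A set of
configurations is measurable if the set of all their labellings is. -/
abbrev Config (r : ℝ) : Type := Quotient (relabelling r)

/-- Forgetting the labels. -/
def forget {r : ℝ} (x : LabelledConfig r) : Config r := Quotient.mk (relabelling r) x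

/-- One step of the deterministic dynamics of labelled particles. -/
def labelledMap {v : ℝ} (hv : 0 < v) (r : ℝ) (x : LabelledConfig r) : LabelledConfig r :=
  ⟨fun i => min (x.1 i + v) (x.1 (i + 1) - 2 * r), fun i => by
    have h1 := x.2 (i + 1)
    have h2 := min_le_right (x.1 i + v) (x.1 (i + 1) - 2 * r)
    have h3 : x.1 (i + 1) ≤ min (x.1 (i + 1) + v) (x.1 (i + 1 + 1) - 2 * r) :=
      le_min (by linarith) (by linarith)
    linarith⟩

/-- The deterministic traffic map on configurations of indistinguishable particles. -/
def trafficMap {v : ℝ} (hv : 0 < v) (r : ℝ) : Config r → Config r :=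
  Quotient.map (labelledMap hv r) (by
    rintro x y ⟨k, hk⟩
    refine ⟨k, fun i => ?_⟩
    simp only [labelledMap]
    rw [hk, hk, add_right_comm i 1 k])

/-- The configuration `c` has density `ρ`: `n / (x_{n-1} - x_0) → ρ`, for each of its
labellings `x`. -/
def HasDensity {r : ℝ} (c : Config r) (ρ : ℝ) : Prop :=
  ∀ x : LabelledConfig r, forget x = c →
    Tendsto (fun n : ℕ => (n : ℝ) / (x.1 ((n : ℤ) - 1) - x.1 0)) atTop (𝓝 ρ)

/-- The number (in `[0, ∞]`) of particles of a configuration in the set `B`, counted with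
multiplicity. -/
def count {r : ℝ} (B : Set ℝ) : Config r → ENNReal :=
  Quotient.lift (fun x : LabelledConfig r => ∑' i : ℤ, B.indicator 1 (x.1 i)) (by
    rintro x y ⟨k, hk⟩
    simp only [hk]
    exact ((Equiv.addRight k).tsum_eq (fun i => B.indicator (1 : ℝ → ENNReal) (x.1 i))).symm)

/-- The measure `μ` has no atoms: each measurable set of positive measure contains a measurable
subset of strictly smaller positive measure. -/
def NonAtomic {α : Type*} [MeasurableSpace α] (μ : Measure α) : Prop :=
  ∀ A : Set α, MeasurableSet A → 0 < μ A →
    ∃ B : Set α, B ⊆ A ∧ MeasurableSet B ∧ 0 < μ B ∧ μ B < μ A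

/-! ### Markov measures on binary sequences -/

/-- `ν` is a stationary (two-sided) Markov measure on `{0,1}^ℤ` with transition matrix `P`. -/
structure IsMarkovMeasure (P : Matrix (Fin 2) (Fin 2) ℝ) (ν : Measure (ℤ → Fin 2)) : Prop where
  isProbabilityMeasure : IsProbabilityMeasure ν
  shiftInvariant : MeasurePreserving (fun (b : ℤ → Fin 2) (i : ℤ) => b (i + 1)) ν ν
  cylinder : ∀ (m : ℤ) (n : ℕ) (a : ℕ → Fin 2),
    ν {b | ∀ k ≤ n, b (m + k) = a k} =
      ν {b | b m = a 0} * ∏ k ∈ Finset.range n, ENNReal.ofReal (P (a k) (a (k + 1)))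

/-- The transition matrix of the lattice Markov measure of density `d ∈ (0, 1]` for the
deterministic lattice map with `v = 1`, `r = 1/2`: if `d ≤ 1/2` two consecutive ones are
forbidden, if `d > 1/2` two consecutive zeros are forbidden. -/
def latticeMatrix (d : ℝ) : Matrix (Fin 2) (Fin 2) ℝ :=
  if d ≤ 1 / 2 then !![1 - d / (1 - d), d / (1 - d); 1, 0]
  else !![0, 1; (1 - d) / d, 1 - (1 - d) / d]

/-! ### From the lattice to the line -/

/-- The first site to the right of `n` that is occupied in `b`. -/
def nextOne (b : ℤ → Fin 2) (n : ℤ) : ℤ := n + 1 + (sInf {k : ℕ | b (n + 1 + k) = 1} : ℕ)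

/-- The first site to the left of `n` that is occupied in `b`. -/
def prevOne (b : ℤ → Fin 2) (n : ℤ) : ℤ := n - 1 - (sInf {k : ℕ | b (n - 1 - k) = 1} : ℕ)

/-- The site of the `i`-th particle of `b`, when the particle at the site `n` has the label `0`. -/
def onePosition (b : ℤ → Fin 2) (n : ℤ) : ℤ → ℤ
  | Int.ofNat k => (nextOne b)^[k] n
  | Int.negSucc k => (prevOne b)^[k + 1] n

theorem onePosition_step (b : ℤ → Fin 2) (n i : ℤ) :
    onePosition b n i + 1 ≤ onePosition b n (i + 1) := by
  rcases i with k | k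
  · have h : onePosition b n (Int.ofNat k + 1) = nextOne b (onePosition b n (Int.ofNat k)) :=
      Function.iterate_succ_apply' (nextOne b) k n
    rw [h, nextOne]
    omega
  · have h : onePosition b n (Int.negSucc k) =
        prevOne b (onePosition b n (Int.negSucc k + 1)) := by
      rcases k with _ | k
      · rfl
      · exact Function.iterate_succ_apply' (prevOne b) (k + 1) n
    rw [h, prevOne]
    omega

/-- The binary sequence `b` as a configuration of balls of radius `1/2`, labelled so that the
particle at the site `n` has the label `0`. -/
def latticeConfig (b : ℤ → Fin 2) (n : ℤ) : LabelledConfig (1 / 2) :=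
  ⟨fun i => (onePosition b n i : ℝ), fun i => by
    have h : ((onePosition b n i + 1 : ℤ) : ℝ) ≤ (onePosition b n (i + 1) : ℝ) :=
      Int.cast_le.mpr (onePosition_step b n i)
    push_cast at h
    linarith⟩

/-- The (σ-finite) lift of a measure on `{0,1}^ℤ` to labelled configurations of balls of radius
`1/2`: every labelling of every binary sequence is taken into account once (the label `0` being
given to each particle in turn). -/
def latticeLift (ν : Measure (ℤ → Fin 2)) : Measure (LabelledConfig (1 / 2)) :=
  Measure.sum fun n : ℤ => (ν.restrict {b | b n = 1}).map fun b => latticeConfig b n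

/-- The change of the radius from `r` to `r'` that keeps all gaps between neighbours; it conjugates
the dynamics of labelled particles of radius `r` and `r'`. -/
def changeRadius {r : ℝ} (r' : ℝ) (x : LabelledConfig r) : LabelledConfig r' :=
  ⟨fun i => x.1 i - 2 * i * (r - r'), fun i => by
    have h := x.2 i
    push_cast
    linarith⟩

/-- The change of variables `z ↦ v z + w`; it turns balls of radius `r / v` into balls of
radius `r`. -/
def rescale {v : ℝ} (hv : 0 < v) (r w : ℝ) (x : LabelledConfig (r / v)) : LabelledConfig r :=
  ⟨fun i => v * x.1 i + w, fun i => by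
    have h := mul_le_mul_of_nonneg_left (x.2 i) hv.le
    have e : v * (r / v) = r := mul_div_cancel₀ r hv.ne'
    rw [mul_add, mul_sub, e] at h
    linarith⟩

/-- The lattice lift of `ν`, after the change of the radius from `1/2` to `r / v` and the change of
variables `z ↦ v z + w`, averaged over `w` uniformly distributed in `[0, v)`. -/
def labelledMeasure {v : ℝ} (hv : 0 < v) (r : ℝ) (ν : Measure (ℤ → Fin 2)) :
    Measure (LabelledConfig r) :=
  ((ProbabilityTheory.cond volume (Set.Ico 0 v)).prod
      ((latticeLift ν).map (changeRadius (r / v)))).map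
    fun p : ℝ × LabelledConfig (r / v) => rescale hv r p.1 p.2

/-- The corresponding law on configurations of indistinguishable particles: one labelling of each
configuration is selected, namely the one in which `0` is the label of the last particle at or to
the left of the origin, the mass is normalized to one, and the labels are forgotten. -/
def continuumMeasure {v : ℝ} (hv : 0 < v) (r : ℝ) (ν : Measure (ℤ → Fin 2)) :
    Measure (Config r) :=
  (ProbabilityTheory.cond (labelledMeasure hv r ν) {x | x.1 0 ≤ 0 ∧ 0 < x.1 1}).map forget

/-- The density of the lattice configuration (`r = 1/2`, `v = 1`) that is turned into a
configuration of density `ρ` of balls of radius `r` by the change of radius and the rescaling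
by `v`. -/
def latticeDensity (v r ρ : ℝ) : ℝ := v * ρ / (1 + 2 * (1 / 2 - r / v) * (v * ρ))

end Traffic

end

/-!
The invariant measure lives on configurations on which the traffic map is a mere translation.  If
`d ≤ 1/2`, the Markov measure `ν` charges only sequences without adjacent ones; after the change of
radius and the rescaling all gaps are at least `v`, and every particle moves by `v`.  If `d > 1/2`,
no two zeros are adjacent, all gaps are at most `v`, and every particle moves up to the next one,
which is a translation by `-2 r` followed by a relabelling (`exists_labelledMap_eq_translate`).
Hence the invariance under the traffic map follows from the invariance under translations.

The averaging over `w` turns the lattice lift into a product: the position of the particle `0` has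
the law `dz / v`, and the rest of the configuration is attached to it according to `ν` restricted
to `{b 0 = 1}` (`lintegral_labelledMeasure`).  This labelled measure is invariant under
translations, and under relabellings because `ν` restricted to `{b 0 = 1}` is invariant under the
first return map (`lintegral_shift_nextOne`).  These two invariances yield a mass transport
principle (`IsStationaryLabelled.lintegral_mul_forget`): integrating `h` over all labelled
configurations is integrating the sum of `h` over all labellings of the configurations in
`{x 0 ≤ 0 < x 1}`.  With `h` the indicator of `{x 0 ≤ s < x 1}` it gives the translation invariance
of the unlabelled law, and with `h` the indicator of `{x 0 ∈ B}` the expected number of particles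
in `B`.  The normalization is the mean gap, known from Kac's formula (`lintegral_nextOne`), and the
law is non-atomic because the position of the last particle to the left of the origin has a bounded
density.

The measure `ν` is obtained from independent bits `u` of parameter `a` by solving the recursion
`c (n + 1) = u (n + 1) && !c n` on all of `ℤ` and, for `d > 1/2`, exchanging the symbols
(`exists_isMarkovMeasure`).  The covariance of two sites is a geometric sequence of ratio `-a` in
their distance, so the variance of the number of particles in `n` sites is at most `n`; along the
squares this is summable, which gives the strong law of large numbers (`ae_tendsto_card_div`) and
the almost sure density in both directions.
-/

namespace Traffic

/-! ### The alternating chain driven by independent bits -/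

open Classical in
/-- The two-sided solution of `c (n + 1) = u (n + 1) && !c n`.  The bit `c n` is the parity of the
length of the run of `true` in `u` that ends at `n`; if this run is infinite, the recursion forces
`c` to alternate there and the bit `θ` selects the phase. -/
noncomputable def chain (θ : Bool) (u : ℤ → Bool) (n : ℤ) : Bool :=
  if h : ∃ k : ℕ, u (n - k) = false then decide (Odd (Nat.find h)) else xor θ (decide (Even n))

theorem chain_eq_of_run {θ : Bool} {u : ℤ → Bool} {n : ℤ} {k : ℕ} (hk : u (n - k) = false)
    (hlt : ∀ j < k, u (n - (j : ℕ)) = true) : chain θ u n = decide (Odd k) := by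
  classical
  have h : ∃ k : ℕ, u (n - k) = false := ⟨k, hk⟩
  have : Nat.find h = k := by
    rw [Nat.find_eq_iff]
    exact ⟨hk, fun j hj => by simp [hlt j hj]⟩
  rw [chain, dif_pos h, this]

theorem chain_eq_of_infinite_run {θ : Bool} {u : ℤ → Bool} {n : ℤ}
    (h : ∀ k : ℕ, u (n - k) = true) : chain θ u n = xor θ (decide (Even n)) := by
  rw [chain, dif_neg]
  simpa using h

theorem finite_or_infinite_run (u : ℤ → Bool) (n : ℤ) :
    (∃ k : ℕ, u (n - k) = false ∧ ∀ j < k, u (n - (j : ℕ)) = true) ∨ ∀ k : ℕ, u (n - k) = true := by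
  classical
  by_cases h : ∃ k : ℕ, u (n - k) = false
  · exact Or.inl ⟨Nat.find h, Nat.find_spec h, fun j hj => by simpa using Nat.find_min h hj⟩
  · exact Or.inr (by simpa using h)

theorem chain_succ (θ : Bool) (u : ℤ → Bool) (n : ℤ) :
    chain θ u (n + 1) = (u (n + 1) && !chain θ u n) := by
  cases hu : u (n + 1) with
  | false =>
    rw [chain_eq_of_run (k := 0) (by simpa using hu) (by simp)]
    simp
  | true =>
    rcases finite_or_infinite_run u n with ⟨k, hk, hlt⟩ | h
    · rw [chain_eq_of_run hk hlt, chain_eq_of_run (k := k + 1)]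
      · simp [Nat.odd_add_one, -Nat.not_odd_iff_even]
      · rw [← hk]; congr 1; push_cast; ring
      · rintro (_ | j) hj
        · simpa using hu
        · rw [← hlt j (by omega)]; congr 1; push_cast; ring
    · rw [chain_eq_of_infinite_run h, chain_eq_of_infinite_run]
      · rcases Int.even_or_odd n with hn | hn <;> cases θ <;> simp [hn]
      · rintro (_ | j)
        · simpa using hu
        · rw [← h j]; congr 1; push_cast; ring

theorem chain_shift (θ : Bool) (u : ℤ → Bool) (n : ℤ) :
    chain (!θ) (fun i => u (i + 1)) n = chain θ u (n + 1) := by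
  have e : ∀ k : ℕ, u (n + 1 - k) = u (n - k + 1) := fun k => by congr 1; ring
  rcases finite_or_infinite_run u (n + 1) with ⟨k, hk, hlt⟩ | h
  · rw [chain_eq_of_run hk hlt, chain_eq_of_run]
    · rw [← e, hk]
    · intro j hj; rw [← e, hlt j hj]
  · rw [chain_eq_of_infinite_run h, chain_eq_of_infinite_run]
    · rcases Int.even_or_odd n with hn | hn <;> cases θ <;> simp [hn]
    · intro j; rw [← e, h j]

/-- The σ-algebra of the bits up to time `n`. -/
abbrev past (n : ℤ) : MeasurableSpace (ℤ → Bool) :=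
  ⨆ i ∈ Set.Iic n, MeasurableSpace.comap (fun u : ℤ → Bool => u i) ⊤

theorem past_le (n : ℤ) : past n ≤ MeasurableSpace.pi :=
  iSup₂_le fun i _ => (measurable_pi_apply i).comap_le

theorem measurableSet_past_eval {n i : ℤ} (hi : i ≤ n) (t : Bool) :
    MeasurableSet[past n] {u : ℤ → Bool | u i = t} :=
  (le_iSup₂_of_le (f := fun i (_ : i ∈ Set.Iic n) =>
    MeasurableSpace.comap (fun u : ℤ → Bool => u i) ⊤) i hi le_rfl) _ ⟨{t}, trivial, rfl⟩

theorem measurableSet_past_chain (θ : Bool) {m n : ℤ} (hmn : m ≤ n) (t : Bool) :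
    MeasurableSet[past n] {u | chain θ u m = t} := by
  have key : {u | chain θ u m = t} =
      (⋃ k : ℕ, {u : ℤ → Bool | decide (Odd k) = t} ∩ ({u | u (m - k) = false} ∩
        ⋂ j : ℕ, ⋂ _ : j < k, {u | u (m - (j : ℕ)) = true})) ∪
      ({u : ℤ → Bool | xor θ (decide (Even m)) = t} ∩ ⋂ k : ℕ, {u | u (m - (k : ℕ)) = true}) := by
    ext u
    simp only [Set.mem_union, Set.mem_iUnion, Set.mem_inter_iff, Set.mem_ofPred_eq, Set.mem_iInter]
    constructor
    · intro h
      rcases finite_or_infinite_run u m with ⟨k, hk, hlt⟩ | h'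
      · exact Or.inl ⟨k, by rw [← h, chain_eq_of_run hk hlt], hk, hlt⟩
      · exact Or.inr ⟨by rw [← h, chain_eq_of_infinite_run h'], h'⟩
    · rintro (⟨k, h, hk, hlt⟩ | ⟨h, h'⟩)
      · rw [chain_eq_of_run hk hlt, h]
      · rw [chain_eq_of_infinite_run h', h]
  rw [key]
  have hev : ∀ (k : ℕ) (s : Bool), MeasurableSet[past n] {u : ℤ → Bool | u (m - k) = s} :=
    fun k s => measurableSet_past_eval (by omega) s
  refine MeasurableSet.union (MeasurableSet.iUnion fun k => ?_) ?_
  · exact (MeasurableSet.const _).inter ((hev k false).inter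
      (MeasurableSet.iInter fun j => MeasurableSet.iInter fun _ => hev j true))
  · exact (MeasurableSet.const _).inter (MeasurableSet.iInter fun k => hev k true)

/-- The law of a single bit, which is `true` with probability `a`. -/
noncomputable def bitLaw (a : ℝ) : Measure Bool :=
  ENNReal.ofReal a • Measure.dirac true + ENNReal.ofReal (1 - a) • Measure.dirac false

theorem isProbabilityMeasure_bitLaw {a : ℝ} (h0 : 0 ≤ a) (h1 : a ≤ 1) :
    IsProbabilityMeasure (bitLaw a) :=
  ⟨by simp [bitLaw, ← ENNReal.ofReal_add h0 (sub_nonneg.2 h1)]⟩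

/-- The law of independent bits. -/
noncomputable def bitsLaw (a : ℝ) : Measure (ℤ → Bool) := Measure.infinitePi fun _ => bitLaw a

/-- The transition probabilities of the chain driven by independent bits. -/
noncomputable def chainProb (a : ℝ) : Bool → Bool → ENNReal
  | true, true => 0
  | true, false => 1
  | false, true => ENNReal.ofReal a
  | false, false => ENNReal.ofReal (1 - a)

open ProbabilityTheory in
/-- The Markov property: the bit `u (n + 1)` is independent of the past. -/
theorem bitsLaw_chain_succ {a : ℝ} (h0 : 0 ≤ a) (h1 : a ≤ 1) (θ : Bool) (n : ℤ)
    {A : Set (ℤ → Bool)} (hA : MeasurableSet[past n] A) (s t : Bool) :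
    bitsLaw a ((A ∩ {u | chain θ u n = s}) ∩ {u | chain θ u (n + 1) = t}) =
      bitsLaw a (A ∩ {u | chain θ u n = s}) * chainProb a s t := by
  have := isProbabilityMeasure_bitLaw h0 h1
  set A' := A ∩ {u | chain θ u n = s} with hA'
  have mA' : MeasurableSet[past n] A' := hA.inter (measurableSet_past_chain θ le_rfl s)
  cases s with
  | true =>
    have hs : ∀ u ∈ A', chain θ u (n + 1) = false := by
      rintro u ⟨-, hu⟩
      simp only [Set.mem_ofPred_eq] at hu
      simp [chain_succ, hu]
    cases t with
    | true =>
      have : A' ∩ {u | chain θ u (n + 1) = true} = ∅ := by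
        ext u
        simp only [Set.mem_inter_iff, Set.mem_ofPred_eq, Set.mem_empty_iff_false, iff_false,
          not_and]
        intro hu
        simp [hs u hu]
      simp [this, chainProb]
    | false =>
      have : A' ∩ {u | chain θ u (n + 1) = false} = A' :=
        Set.inter_eq_left.2 hs
      simp [this, chainProb]
  | false =>
    have e : A' ∩ {u | chain θ u (n + 1) = t} = A' ∩ {u | u (n + 1) = t} := by
      ext u
      simp only [Set.mem_inter_iff, Set.mem_ofPred_eq, and_congr_right_iff]
      rintro ⟨-, hu⟩
      simp only [Set.mem_ofPred_eq] at hu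
      simp [chain_succ, hu]
    have hind : iIndepFun (fun (i : ℤ) (u : ℤ → Bool) => u i) (bitsLaw a) :=
      iIndepFun_infinitePi (P := fun _ : ℤ => bitLaw a) (X := fun _ x => x)
        (fun _ => measurable_id)
    have hind' := indep_iSup_of_disjoint (fun i => (measurable_pi_apply i).comap_le)
      hind (S := Set.Iic n) (T := {n + 1}) (by simp)
    have hT : MeasurableSet[⨆ i ∈ ({n + 1} : Set ℤ), MeasurableSpace.comap
        (fun u : ℤ → Bool => u i) ⊤] {u : ℤ → Bool | u (n + 1) = t} :=
      (le_iSup₂_of_le (f := fun i (_ : i ∈ ({n + 1} : Set ℤ)) =>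
        MeasurableSpace.comap (fun u : ℤ → Bool => u i) ⊤) (n + 1) rfl le_rfl) _ ⟨{t}, trivial, rfl⟩
    rw [e, (Indep_iff _ _ _).1 hind' A' _ mA' hT]
    congr 1
    have : {u : ℤ → Bool | u (n + 1) = t} = (fun u => u (n + 1)) ⁻¹' {t} := rfl
    rw [this, ← Measure.map_apply (measurable_pi_apply _) (measurableSet_singleton _), bitsLaw,
      Measure.infinitePi_map_eval]
    cases t <;> simp [bitLaw, chainProb]

theorem measurePreserving_shift_bitsLaw {a : ℝ} (h0 : 0 ≤ a) (h1 : a ≤ 1) :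
    MeasurePreserving (fun (u : ℤ → Bool) i => u (i + 1)) (bitsLaw a) (bitsLaw a) := by
  have := isProbabilityMeasure_bitLaw h0 h1
  refine ⟨by fun_prop, ?_⟩
  exact Measure.map_infinitePi_infinitePi_of_inj (P := fun _ : ℤ => bitLaw a)
    (f := fun i : ℤ => i + 1) (add_left_injective 1)

/-! ### The stationary Markov measure -/

theorem measurableSet_site (m : ℤ) (z : Fin 2) : MeasurableSet {b : ℤ → Fin 2 | b m = z} :=
  measurableSet_eq_fun (measurable_pi_apply m) measurable_const

/-- The binary sequence read off the chain: the symbol `1` stands for `true` if `s = false`, and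
for `false` if `s = true`. -/
noncomputable def chainSymbols (s θ : Bool) (u : ℤ → Bool) (n : ℤ) : Fin 2 :=
  if chain θ u n = s then 0 else 1

/-- The bit of the chain that is read as the symbol `x`. -/
def symbolBit (s : Bool) (x : Fin 2) : Bool := if x = 0 then s else !s

theorem chainSymbols_eq_iff (s θ : Bool) (u : ℤ → Bool) (n : ℤ) (x : Fin 2) :
    chainSymbols s θ u n = x ↔ chain θ u n = symbolBit s x := by
  unfold chainSymbols symbolBit
  fin_cases x <;> cases chain θ u n <;> cases s <;> simp

theorem measurableSet_past_chainSymbols (s θ : Bool) {m n : ℤ} (hmn : m ≤ n) (x : Fin 2) :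
    MeasurableSet[past n] {u | chainSymbols s θ u m = x} := by
  simp only [chainSymbols_eq_iff]
  exact measurableSet_past_chain θ hmn _

theorem measurable_chainSymbols (s θ : Bool) : Measurable (chainSymbols s θ) := by
  refine measurable_pi_iff.2 fun n => measurable_to_countable' fun x => ?_
  exact past_le n _ (measurableSet_past_chainSymbols s θ le_rfl x)

/-- The law of the symbols of the chain, with a uniformly distributed phase. -/
noncomputable def chainLaw (a : ℝ) (s : Bool) : Measure (ℤ → Fin 2) :=
  (2⁻¹ : ENNReal) • ((bitsLaw a).map (chainSymbols s false) +
    (bitsLaw a).map (chainSymbols s true))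

theorem chainLaw_apply (a : ℝ) (s : Bool) {E : Set (ℤ → Fin 2)} (hE : MeasurableSet E) :
    chainLaw a s E = 2⁻¹ * (bitsLaw a (chainSymbols s false ⁻¹' E) +
      bitsLaw a (chainSymbols s true ⁻¹' E)) := by
  simp [chainLaw, Measure.map_apply (measurable_chainSymbols s _) hE, mul_add]

theorem isProbabilityMeasure_chainLaw {a : ℝ} (h0 : 0 ≤ a) (h1 : a ≤ 1) (s : Bool) :
    IsProbabilityMeasure (chainLaw a s) := by
  have := isProbabilityMeasure_bitLaw h0 h1
  have : IsProbabilityMeasure (bitsLaw a) := by unfold bitsLaw; infer_instance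
  refine ⟨?_⟩
  rw [chainLaw_apply a s MeasurableSet.univ]
  simp [one_add_one_eq_two, ENNReal.inv_mul_cancel]

/-- The shift of the bits shifts the chain and exchanges the two phases. -/
theorem measurePreserving_shift_chainLaw {a : ℝ} (h0 : 0 ≤ a) (h1 : a ≤ 1) (s : Bool) :
    MeasurePreserving (fun (b : ℤ → Fin 2) i => b (i + 1)) (chainLaw a s) (chainLaw a s) := by
  have hm : Measurable fun (b : ℤ → Fin 2) (i : ℤ) => b (i + 1) := by fun_prop
  refine ⟨hm, Measure.ext fun E hE => ?_⟩
  have key : ∀ θ, bitsLaw a (chainSymbols s θ ⁻¹' ((fun b (i : ℤ) => b (i + 1)) ⁻¹' E)) =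
      bitsLaw a (chainSymbols s (!θ) ⁻¹' E) := by
    intro θ
    rw [← (measurePreserving_shift_bitsLaw h0 h1).measure_preimage
      (measurable_chainSymbols s (!θ) hE).nullMeasurableSet]
    congr 1
    ext u
    have : chainSymbols s (!θ) (fun i => u (i + 1)) = fun i => chainSymbols s θ u (i + 1) := by
      funext n
      simp only [chainSymbols, chain_shift]
    simp only [Set.mem_preimage, this]
  rw [Measure.map_apply hm hE, chainLaw_apply a s (hm hE), chainLaw_apply a s hE, key, key,
    add_comm]
  rfl

theorem chainLaw_succ {a : ℝ} (h0 : 0 ≤ a) (h1 : a ≤ 1) (s : Bool) (n : ℤ)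
    {E : Set (ℤ → Fin 2)} (hE : MeasurableSet E)
    (hpast : ∀ θ, MeasurableSet[past n] (chainSymbols s θ ⁻¹' E)) (x y : Fin 2) :
    chainLaw a s ((E ∩ {b | b n = x}) ∩ {b | b (n + 1) = y}) =
      chainLaw a s (E ∩ {b | b n = x}) * chainProb a (symbolBit s x) (symbolBit s y) := by
  have hev : ∀ (m : ℤ) (z : Fin 2), MeasurableSet {b : ℤ → Fin 2 | b m = z} := fun m z =>
    measurableSet_site m z
  have key := fun θ => bitsLaw_chain_succ h0 h1 θ n (hpast θ) (symbolBit s x) (symbolBit s y)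
  rw [chainLaw_apply a s ((hE.inter (hev _ _)).inter (hev _ _)),
    chainLaw_apply a s (hE.inter (hev _ _)), mul_assoc, add_mul]
  have hpre : ∀ θ (m : ℤ) z, chainSymbols s θ ⁻¹' {b | b m = z} =
      {u | chain θ u m = symbolBit s z} := fun θ m z =>
    Set.ext fun u => chainSymbols_eq_iff s θ u m z
  simp only [Set.preimage_inter, hpre, key]

theorem chainLaw_cylinder {a : ℝ} (h0 : 0 ≤ a) (h1 : a ≤ 1) (s : Bool) (m : ℤ) (n : ℕ)
    (w : ℕ → Fin 2) :
    chainLaw a s {b | ∀ k ≤ n, b (m + k) = w k} = chainLaw a s {b | b m = w 0} *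
      ∏ k ∈ Finset.range n, chainProb a (symbolBit s (w k)) (symbolBit s (w (k + 1))) := by
  induction n with
  | zero => simp
  | succ n ih =>
    have e : {b : ℤ → Fin 2 | ∀ k ≤ n, b (m + k) = w k} =
        ⋂ k : ℕ, ⋂ _ : k ≤ n, {b : ℤ → Fin 2 | b (m + k) = w k} := by
      ext b; simp
    have hE : MeasurableSet {b : ℤ → Fin 2 | ∀ k ≤ n, b (m + k) = w k} := by
      rw [e]
      exact MeasurableSet.iInter fun k => MeasurableSet.iInter fun _ =>
        measurableSet_site _ _
    have hpast : ∀ θ, MeasurableSet[past (m + n)]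
        (chainSymbols s θ ⁻¹' {b : ℤ → Fin 2 | ∀ k ≤ n, b (m + k) = w k}) := by
      intro θ
      rw [e, Set.preimage_iInter₂]
      exact MeasurableSet.iInter fun k => MeasurableSet.iInter fun hk =>
        measurableSet_past_chainSymbols s θ (by omega) _
    have e1 : {b : ℤ → Fin 2 | ∀ k ≤ n, b (m + k) = w k} ∩ {b | b (m + n) = w n} =
        {b : ℤ → Fin 2 | ∀ k ≤ n, b (m + k) = w k} :=
      Set.inter_eq_left.2 fun b hb => hb n le_rfl
    have e2 : {b : ℤ → Fin 2 | ∀ k ≤ n + 1, b (m + k) = w k} =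
        {b : ℤ → Fin 2 | ∀ k ≤ n, b (m + k) = w k} ∩ {b | b (m + n + 1) = w (n + 1)} := by
      ext b
      simp only [Set.mem_ofPred_eq, Set.mem_inter_iff]
      constructor
      · intro h
        exact ⟨fun k hk => h k (by omega), by simpa [add_assoc] using h (n + 1) le_rfl⟩
      · rintro ⟨h, h'⟩ k hk
        rcases Nat.lt_or_eq_of_le hk with hk | rfl
        · exact h k (by omega)
        · simpa [add_assoc] using h'
    have key := chainLaw_succ h0 h1 s (m + n) hE hpast (w n) (w (n + 1))
    rw [e1] at key
    rw [e2, key, ih, Finset.prod_range_succ, mul_assoc]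

/-- Existence of the stationary Markov measure, together with the Markov property for pairs of
sites at an arbitrary distance. -/
theorem exists_isMarkovMeasure {d : ℝ} (hd0 : 0 < d) (hd1 : d ≤ 1) :
    ∃ ν : Measure (ℤ → Fin 2), IsMarkovMeasure (latticeMatrix d) ν ∧
      ∀ (n : ℕ) (x y : Fin 2), ν ({b | b 0 = 1} ∩ {b | b n = x} ∩ {b | b (n + 1) = y}) =
        ν ({b | b 0 = 1} ∩ {b | b n = x}) * ENNReal.ofReal (latticeMatrix d x y) := by
  -- For `d > 1/2` the ones are the `false` bits of the chain, which never has two adjacent `true`s.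
  obtain ⟨a, s, h0, h1, hP⟩ : ∃ (a : ℝ) (s : Bool), 0 ≤ a ∧ a ≤ 1 ∧
      ∀ x y, chainProb a (symbolBit s x) (symbolBit s y) =
        ENNReal.ofReal (latticeMatrix d x y) := by
    by_cases hd : d ≤ 1 / 2
    · refine ⟨d / (1 - d), false, div_nonneg hd0.le (by linarith), ?_, fun x y => ?_⟩
      · rw [div_le_one (by linarith)]; linarith
      · rw [latticeMatrix, if_pos hd]
        fin_cases x <;> fin_cases y <;> simp [symbolBit, chainProb]
    · push Not at hd
      refine ⟨(1 - d) / d, true, div_nonneg (by linarith) hd0.le, ?_, fun x y => ?_⟩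
      · rw [div_le_one (by linarith)]; linarith
      · rw [latticeMatrix, if_neg hd.not_ge]
        fin_cases x <;> fin_cases y <;> simp [symbolBit, chainProb]
  refine ⟨chainLaw a s, ⟨isProbabilityMeasure_chainLaw h0 h1 s,
    measurePreserving_shift_chainLaw h0 h1 s, fun m n w => ?_⟩, fun n x y => ?_⟩
  · rw [chainLaw_cylinder h0 h1]
    simp only [hP]
  · rw [← hP]
    exact chainLaw_succ h0 h1 s n (measurableSet_site 0 1)
      (fun θ => measurableSet_past_chainSymbols s θ (by omega) 1) x y

/-! ### A strong law of large numbers for geometrically alternating correlations -/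

section StrongLaw

variable {Ω : Type*} [MeasurableSpace Ω] {P : Measure Ω}

/-- If the correlation of the centred variables `Y j` and `Y n` is multiplied by `-a ∈ [-1, 0]` when
`n` increases by one, the correlation of `Y n` with the sum of its predecessors stays in
`[-σ, 0]`, so that the variance of the sums grows at most linearly. -/
theorem integral_sum_sq_le [IsProbabilityMeasure P] {Y : ℕ → Ω → ℝ} (hY : ∀ n, Measurable (Y n))
    (hb : ∀ n ω, |Y n ω| ≤ 1) {a σ : ℝ} (h0 : 0 ≤ a) (h1 : a ≤ 1)
    (hσ : ∀ n, ∫ ω, Y n ω * Y n ω ∂P = σ)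
    (hcorr : ∀ j n, j ≤ n → ∫ ω, Y j ω * Y (n + 1) ω ∂P = -a * ∫ ω, Y j ω * Y n ω ∂P) (n : ℕ) :
    ∫ ω, (∑ i ∈ Finset.range n, Y i ω) ^ 2 ∂P ≤ n := by
  have hint : ∀ i j, Integrable (fun ω => Y i ω * Y j ω) P := fun i j =>
    Integrable.of_bound ((hY i).mul (hY j)).aestronglyMeasurable 1 (ae_of_all _ fun ω => by
      rw [Real.norm_eq_abs, abs_mul]
      exact mul_le_one₀ (hb i ω) (abs_nonneg _) (hb j ω))
  have hint2 : ∀ n j, Integrable (fun ω => (∑ i ∈ Finset.range n, Y i ω) * Y j ω) P := by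
    intro n j
    simp_rw [Finset.sum_mul]
    exact integrable_finsetSum _ fun i _ => hint i j
  have hint3 : ∀ n, Integrable (fun ω => (∑ i ∈ Finset.range n, Y i ω) ^ 2) P := by
    intro n
    simp_rw [sq, Finset.mul_sum]
    exact integrable_finsetSum _ fun i _ => hint2 n i
  have hσ1 : σ ≤ 1 := by
    rw [← hσ 0]
    calc ∫ ω, Y 0 ω * Y 0 ω ∂P ≤ ∫ _, (1 : ℝ) ∂P := by
          refine integral_mono (hint 0 0) (integrable_const _) fun ω => ?_
          have := hb 0 ω
          have h := abs_le.1 this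
          dsimp only
          nlinarith
      _ = 1 := by simp
  have hC : ∀ n, ∫ ω, (∑ i ∈ Finset.range n, Y i ω) * Y n ω ∂P ≤ 0 ∧
      -σ ≤ ∫ ω, (∑ i ∈ Finset.range n, Y i ω) * Y n ω ∂P := by
    have hσ0 : 0 ≤ σ := by
      rw [← hσ 0]
      exact integral_nonneg fun ω => mul_self_nonneg _
    intro n
    induction n with
    | zero => simp [hσ0]
    | succ n ih =>
      have e : ∫ ω, (∑ i ∈ Finset.range (n + 1), Y i ω) * Y (n + 1) ω ∂P =
          -a * (∫ ω, (∑ i ∈ Finset.range n, Y i ω) * Y n ω ∂P + σ) := by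
        rw [← hσ n, ← integral_add (hint2 n n) (hint n n)]
        simp_rw [← add_mul, ← Finset.sum_range_succ, Finset.sum_mul]
        rw [integral_finsetSum _ fun i _ => hint i _, integral_finsetSum _ fun i _ => hint i _,
          Finset.mul_sum]
        exact Finset.sum_congr rfl fun j hj => hcorr j n (by simp at hj; omega)
      rw [e]
      constructor
      · nlinarith
      · nlinarith
  have hV : ∫ ω, (∑ i ∈ Finset.range n, Y i ω) ^ 2 ∂P ≤ n * σ := by
    induction n with
    | zero => simp
    | succ n ih =>
      have e : ∫ ω, (∑ i ∈ Finset.range (n + 1), Y i ω) ^ 2 ∂P =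
          ∫ ω, (∑ i ∈ Finset.range n, Y i ω) ^ 2 ∂P +
            (2 * ∫ ω, (∑ i ∈ Finset.range n, Y i ω) * Y n ω ∂P + σ) := by
        have i2 : Integrable (fun ω => 2 * ((∑ i ∈ Finset.range n, Y i ω) * Y n ω) +
            Y n ω * Y n ω) P := ((hint2 n n).const_mul 2).add (hint n n)
        rw [← hσ n, ← integral_const_mul, ← integral_add ((hint2 n n).const_mul 2) (hint n n),
          ← integral_add (hint3 n) i2]
        refine integral_congr_ae (ae_of_all _ fun ω => ?_)
        simp only [Finset.sum_range_succ]
        ring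
      rw [e]
      push_cast
      linarith [(hC n).1]
  refine hV.trans ?_
  nlinarith [Nat.cast_nonneg (α := ℝ) n]

/-- If the second moment of `T n` is at most `n`, then `T (n ^ 2) / n ^ 2 → 0` almost surely, by the
summability of `1 / n ^ 2`. -/
theorem ae_tendsto_sq_div_of_integral_sq_le {T : ℕ → Ω → ℝ} (hT : ∀ n, Measurable (T n))
    (hint : ∀ n, Integrable (fun ω => T n ω ^ 2) P) (hV : ∀ n, ∫ ω, T n ω ^ 2 ∂P ≤ n) :
    ∀ᵐ ω ∂P, Tendsto (fun n : ℕ => T (n ^ 2) ω / ((n ^ 2 : ℕ) : ℝ)) atTop (𝓝 0) := by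
  have hm : ∀ n : ℕ, Measurable fun ω => ENNReal.ofReal ((T (n ^ 2) ω / ((n ^ 2 : ℕ) : ℝ)) ^ 2) :=
    fun n => (((hT _).div_const _).pow_const 2).ennreal_ofReal
  have hsum : ∫⁻ ω, ∑' n : ℕ, ENNReal.ofReal ((T (n ^ 2) ω / ((n ^ 2 : ℕ) : ℝ)) ^ 2) ∂P ≠ ⊤ := by
    rw [lintegral_tsum fun n => (hm n).aemeasurable]
    have hle : ∀ n : ℕ, ∫⁻ ω, ENNReal.ofReal ((T (n ^ 2) ω / ((n ^ 2 : ℕ) : ℝ)) ^ 2) ∂P ≤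
        ENNReal.ofReal (1 / (n : ℝ) ^ 2) := by
      intro n
      rw [← ofReal_integral_eq_lintegral_ofReal]
      · refine ENNReal.ofReal_le_ofReal ?_
        simp_rw [div_pow]
        rw [integral_div]
        rcases Nat.eq_zero_or_pos n with rfl | hn
        · simp
        · have hn' : (0 : ℝ) < n := by exact_mod_cast hn
          have := hV (n ^ 2)
          rw [div_le_div_iff₀ (by positivity) (by positivity)]
          push_cast at this ⊢
          nlinarith [sq_nonneg (n : ℝ)]
      · simp_rw [div_pow]
        exact (hint _).div_const _
      · exact ae_of_all _ fun ω => sq_nonneg _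
    refine ne_top_of_le_ne_top ?_ (ENNReal.tsum_le_tsum hle)
    rw [← ENNReal.ofReal_tsum_of_nonneg (fun n => by positivity)
      (Real.summable_one_div_nat_pow.2 one_lt_two)]
    exact ENNReal.ofReal_ne_top
  filter_upwards [ae_lt_top (Measurable.tsum hm) hsum] with ω hω
  have h1 := ENNReal.tendsto_atTop_zero_of_tsum_ne_top hω.ne
  have h2 : Tendsto (fun n : ℕ => (T (n ^ 2) ω / ((n ^ 2 : ℕ) : ℝ)) ^ 2) atTop (𝓝 0) := by
    have := (ENNReal.tendsto_toReal ENNReal.zero_ne_top).comp h1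
    refine this.congr fun n => ?_
    exact ENNReal.toReal_ofReal (sq_nonneg _)
  have h3 := h2.sqrt
  simp only [Real.sqrt_sq_eq_abs, Real.sqrt_zero] at h3
  exact (tendsto_zero_iff_abs_tendsto_zero _).2 h3

/-- The strong law of large numbers for events of equal probability `d`, whose correlations are
`c k` at distance `k`, where `c k - d ^ 2` is a geometric sequence of ratio in `[-1, 0]`. -/
theorem ae_tendsto_card_div [IsProbabilityMeasure P] {A : ℕ → Set Ω}
    (hA : ∀ n, MeasurableSet (A n)) {a d : ℝ}
    (h0 : 0 ≤ a) (h1 : a ≤ 1) (hd0 : 0 ≤ d) (hd1 : d ≤ 1) {c : ℕ → ℝ}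
    (hd : ∀ n, P.real (A n) = d) (hc : ∀ j k, P.real (A j ∩ A (j + k)) = c k)
    (hca : ∀ k, c (k + 1) - d ^ 2 = -a * (c k - d ^ 2)) :
    ∀ᵐ ω ∂P, Tendsto
      (fun n : ℕ => (∑ i ∈ Finset.range n, (A i).indicator (1 : Ω → ℝ) ω) / n) atTop (𝓝 d) := by
  set Y : ℕ → Ω → ℝ := fun i ω => (A i).indicator (1 : Ω → ℝ) ω - d with hYdef
  have hm : ∀ i, Measurable ((A i).indicator (1 : Ω → ℝ)) := fun i =>
    measurable_one.indicator (hA i)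
  have hY : ∀ n, Measurable (Y n) := fun n => (hm n).sub_const d
  have hb : ∀ n ω, |Y n ω| ≤ 1 := by
    intro n ω
    rw [abs_le]
    by_cases h : ω ∈ A n <;> simp [hYdef, h] <;> constructor <;> linarith
  have hI : ∀ i, Integrable ((A i).indicator (1 : Ω → ℝ)) P := fun i =>
    (integrable_const (1 : ℝ)).indicator (hA i)
  have hcov : ∀ j k, ∫ ω, Y j ω * Y (j + k) ω ∂P = c k - d ^ 2 := by
    intro j k
    have hind : ∀ B : Set Ω, MeasurableSet B →
        ∫ ω, B.indicator (1 : Ω → ℝ) ω ∂P = P.real B := fun B hB => integral_indicator_one hB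
    have e : ∀ ω, Y j ω * Y (j + k) ω = (A j ∩ A (j + k)).indicator (1 : Ω → ℝ) ω -
        d * (A j).indicator (1 : Ω → ℝ) ω - d * (A (j + k)).indicator (1 : Ω → ℝ) ω + d ^ 2 := by
      intro ω
      rw [Set.inter_indicator_one]
      simp only [hYdef, Pi.mul_apply]
      ring
    have i1 : Integrable ((A j ∩ A (j + k)).indicator (1 : Ω → ℝ)) P :=
      (integrable_const (1 : ℝ)).indicator ((hA _).inter (hA _))
    have i2 : Integrable (fun ω => (A j ∩ A (j + k)).indicator (1 : Ω → ℝ) ω -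
        d * (A j).indicator (1 : Ω → ℝ) ω) P := i1.sub ((hI j).const_mul d)
    have i3 : Integrable (fun ω => (A j ∩ A (j + k)).indicator (1 : Ω → ℝ) ω -
        d * (A j).indicator (1 : Ω → ℝ) ω - d * (A (j + k)).indicator (1 : Ω → ℝ) ω) P :=
      i2.sub ((hI _).const_mul d)
    simp_rw [e]
    rw [integral_add i3 (integrable_const _), integral_sub i2 ((hI _).const_mul d),
      integral_sub i1 ((hI j).const_mul d), integral_const_mul, integral_const_mul,
      hind _ (hA _), hind _ (hA _), hind _ ((hA _).inter (hA _)), hd, hd, hc]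
    simp
    ring
  have hV := fun n => integral_sum_sq_le (P := P) hY hb h0 h1 (σ := c 0 - d ^ 2)
    (fun n => hcov n 0) (fun j n hjn => by
      obtain ⟨k, rfl⟩ := Nat.exists_eq_add_of_le hjn
      rw [add_assoc, hcov, hcov, hca]) n
  have hT : ∀ n, Measurable fun ω => ∑ i ∈ Finset.range n, Y i ω := fun n =>
    Finset.measurable_sum _ fun i _ => hY i
  have hbT : ∀ n ω, |∑ i ∈ Finset.range n, Y i ω| ≤ n := fun n ω =>
    (Finset.abs_sum_le_sum_abs _ _).trans
      ((Finset.sum_le_sum fun i _ => hb i ω).trans (by simp))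
  have hint : ∀ n, Integrable (fun ω => (∑ i ∈ Finset.range n, Y i ω) ^ 2) P := fun n =>
    Integrable.of_bound ((hT n).pow_const 2).aestronglyMeasurable ((n : ℝ) ^ 2)
      (ae_of_all _ fun ω => by
        rw [Real.norm_eq_abs, abs_pow]
        exact pow_le_pow_left₀ (abs_nonneg _) (hbT n ω) 2)
  filter_upwards [ae_tendsto_sq_div_of_integral_sq_le hT hint hV] with ω hω
  refine tendsto_div_of_monotone_of_exists_subseq_tendsto_div
    (fun n => ∑ i ∈ Finset.range n, (A i).indicator (1 : Ω → ℝ) ω) d ?_ ?_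
  · refine monotone_nat_of_le_succ fun n => ?_
    rw [Finset.sum_range_succ]
    exact le_add_of_nonneg_right (Set.indicator_nonneg (fun _ _ => zero_le_one) _)
  · intro r hr
    refine ⟨fun n => n ^ 2, ?_, tendsto_pow_atTop two_ne_zero, ?_⟩
    · have h1 : Tendsto (fun n : ℕ => (1 + 1 / (n : ℝ)) ^ 2) atTop (𝓝 1) := by
        simpa using ((tendsto_const_nhds (x := (1 : ℝ))).add
          (tendsto_one_div_atTop_nhds_zero_nat (𝕜 := ℝ))).pow 2
      filter_upwards [h1.eventually (gt_mem_nhds hr), eventually_gt_atTop 0] with n hn hn0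
      have hn' : (0 : ℝ) < n := by exact_mod_cast hn0
      have e : (((n + 1) ^ 2 : ℕ) : ℝ) = (1 + 1 / (n : ℝ)) ^ 2 * ((n ^ 2 : ℕ) : ℝ) := by
        push_cast; field_simp
      rw [e]
      gcongr
    · have := hω.add_const d
      rw [zero_add] at this
      refine this.congr' ?_
      filter_upwards [eventually_gt_atTop 0] with n hn
      have hn' : (((n ^ 2 : ℕ) : ℝ)) ≠ 0 := by positivity
      simp only [hYdef, Finset.sum_sub_distrib, Finset.sum_const, Finset.card_range, nsmul_eq_mul]
      field_simp
      ring

end StrongLaw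

/-! ### Stationary Markov measures of density `d` -/

section Markov

variable {d : ℝ} {ν : Measure (ℤ → Fin 2)}

theorem fin_two_cases (x : Fin 2) : x = 0 ∨ x = 1 := by fin_cases x <;> simp

theorem measure_inter_zero_add_inter_one (E : Set (ℤ → Fin 2)) (n : ℤ) :
    ν (E ∩ {b | b n = 0}) + ν (E ∩ {b | b n = 1}) = ν E := by
  rw [add_comm, ← measure_inter_add_sdiff E (measurableSet_site n 1)]
  congr 2
  ext b
  rcases fin_two_cases (b n) with h | h <;> simp [h]

theorem latticeMatrix_nonneg (hd0 : 0 < d) (hd1 : d ≤ 1) (x y : Fin 2) :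
    0 ≤ latticeMatrix d x y := by
  unfold latticeMatrix
  split_ifs with h
  · have h1 : d / (1 - d) ≤ 1 := by rw [div_le_one (by linarith)]; linarith
    have h0 : 0 ≤ d / (1 - d) := div_nonneg hd0.le (by linarith)
    fin_cases x <;> fin_cases y <;> simp [h0, h1]
  · have h1 : (1 - d) / d ≤ 1 := by rw [div_le_one hd0]; linarith
    have h0 : 0 ≤ (1 - d) / d := div_nonneg (by linarith) hd0.le
    fin_cases x <;> fin_cases y <;> simp [h0, h1]

/-- The one-step transition into the state `1` contracts by a factor in `[-1, 0]` towards the fixed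
point `d`. -/
theorem exists_latticeMatrix_contraction (hd0 : 0 < d) (hd1 : d ≤ 1) :
    ∃ a : ℝ, 0 ≤ a ∧ a ≤ 1 ∧ ∀ p c : ℝ, (p - c) * latticeMatrix d 0 1 + c * latticeMatrix d 1 1 =
      p * d - a * (c - p * d) := by
  by_cases h : d ≤ 1 / 2
  · have h2 : (1 - d) ≠ 0 := by linarith
    refine ⟨d / (1 - d), div_nonneg hd0.le (by linarith), ?_, fun p c => ?_⟩
    · rw [div_le_one (by linarith)]; linarith
    · simp only [latticeMatrix, if_pos h, Matrix.of_apply, Matrix.cons_val', Matrix.cons_val_zero,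
        Matrix.cons_val_one, Matrix.cons_val_fin_one]
      field_simp
      ring
  · push Not at h
    refine ⟨(1 - d) / d, div_nonneg (by linarith) hd0.le, ?_, fun p c => ?_⟩
    · rw [div_le_one (by linarith)]; linarith
    · simp only [latticeMatrix, if_neg h.not_ge, Matrix.of_apply, Matrix.cons_val',
        Matrix.cons_val_zero, Matrix.cons_val_one, Matrix.cons_val_fin_one]
      field_simp
      ring

theorem measurePreserving_shift (hν : IsMarkovMeasure (latticeMatrix d) ν) (n : ℤ) :
    MeasurePreserving (fun (b : ℤ → Fin 2) i => b (n + i)) ν ν := by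
  have hinv : MeasurePreserving (fun (b : ℤ → Fin 2) i => b (i - 1)) ν ν := by
    refine ⟨by fun_prop, ?_⟩
    conv_lhs => rw [← hν.shiftInvariant.map_eq, Measure.map_map (by fun_prop) (by fun_prop)]
    have : (fun (b : ℤ → Fin 2) (i : ℤ) => b (i - 1)) ∘ (fun b (i : ℤ) => b (i + 1)) = id := by
      funext b i; simp
    rw [this, Measure.map_id]
  induction n with
  | zero =>
    simp only [zero_add]
    exact MeasurePreserving.id ν
  | succ n ih =>
    convert ih.comp hν.shiftInvariant using 1
    funext b i
    simp only [Function.comp]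
    congr 1; ring
  | pred n ih =>
    convert ih.comp hinv using 1
    funext b i
    simp only [Function.comp]
    congr 1; ring

theorem measure_shift (hν : IsMarkovMeasure (latticeMatrix d) ν) (n : ℤ) {E : Set (ℤ → Fin 2)}
    (hE : MeasurableSet E) : ν {b | (fun i => b (n + i)) ∈ E} = ν E :=
  (measurePreserving_shift hν n).measure_preimage hE.nullMeasurableSet

theorem measure_pair (hν : IsMarkovMeasure (latticeMatrix d) ν) (x y : Fin 2) :
    ν ({b | b 0 = x} ∩ {b | b 1 = y}) =
      ν {b | b 0 = x} * ENNReal.ofReal (latticeMatrix d x y) := by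
  have h := hν.cylinder 0 1 (fun k => if k = 0 then x else y)
  simp only [Finset.prod_range_one, if_true, if_false, one_ne_zero, zero_add] at h
  rw [← h]
  congr 1
  ext b
  simp only [Set.mem_inter_iff, Set.mem_ofPred_eq]
  constructor
  · rintro ⟨h0, h1⟩ k hk
    interval_cases k <;> simpa
  · intro h
    exact ⟨by simpa using h 0 (by simp), by simpa using h 1 le_rfl⟩

/-- A stationary Markov measure with matrix `latticeMatrix d` has density `d`. -/
theorem measure_one (hd0 : 0 < d) (hd1 : d ≤ 1) (hν : IsMarkovMeasure (latticeMatrix d) ν) (n : ℤ) :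
    ν {b | b n = 1} = ENNReal.ofReal d := by
  have := hν.isProbabilityMeasure
  have hn : ν {b | b n = 1} = ν {b | b 0 = 1} := by
    simpa using measure_shift hν n (measurableSet_site 0 1)
  have h1 : ν {b | b 1 = 1} = ν {b | b 0 = 1} := by
    simpa using measure_shift hν 1 (measurableSet_site 0 1)
  have h00 := measure_pair hν 0 1
  have h11 := measure_pair hν 1 1
  have hsum : ν {b | b 0 = 0} + ν {b | b 0 = 1} = 1 := by
    simpa using measure_inter_zero_add_inter_one (ν := ν) Set.univ 0
  have hsum1 : ν ({b | b 0 = 0} ∩ {b | b 1 = 1}) + ν ({b | b 0 = 1} ∩ {b | b 1 = 1}) =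
      ν {b | b 0 = 1} := by
    have := measure_inter_zero_add_inter_one (ν := ν) {b | b 1 = 1} 0
    rw [Set.inter_comm, Set.inter_comm {b : ℤ → Fin 2 | b 0 = 1}, this, h1]
  rw [h00, h11] at hsum1
  obtain ⟨a, h0, -, ha⟩ := exists_latticeMatrix_contraction hd0 hd1
  set p := (ν {b | b 0 = 1}).toReal with hp
  have e1 : (ν {b | b 0 = 0}).toReal = 1 - p := by
    have := congrArg ENNReal.toReal hsum
    rw [ENNReal.toReal_add (measure_ne_top _ _) (measure_ne_top _ _)] at this
    simp only [ENNReal.toReal_one] at this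
    linarith
  have e2 : (1 - p) * latticeMatrix d 0 1 + p * latticeMatrix d 1 1 = p := by
    have := congrArg ENNReal.toReal hsum1
    rwa [ENNReal.toReal_add (ENNReal.mul_ne_top (measure_ne_top _ _) ENNReal.ofReal_ne_top)
      (ENNReal.mul_ne_top (measure_ne_top _ _) ENNReal.ofReal_ne_top), ENNReal.toReal_mul,
      ENNReal.toReal_mul, ENNReal.toReal_ofReal (latticeMatrix_nonneg hd0 hd1 _ _),
      ENNReal.toReal_ofReal (latticeMatrix_nonneg hd0 hd1 _ _), e1] at this
  rw [ha] at e2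
  have e3 : p = d := by
    have : (1 + a) * (p - d) = 0 := by linarith
    rcases mul_eq_zero.1 this with h | h <;> linarith
  rw [hn, ← e3, hp, ENNReal.ofReal_toReal (measure_ne_top _ _)]

/-- The Markov property for the event that the site `0` is occupied. -/
def MarkovAtPairs (d : ℝ) (ν : Measure (ℤ → Fin 2)) : Prop :=
  ∀ (n : ℕ) (x y : Fin 2), ν ({b | b 0 = 1} ∩ {b | b n = x} ∩ {b | b (n + 1) = y}) =
    ν ({b | b 0 = 1} ∩ {b | b n = x}) * ENNReal.ofReal (latticeMatrix d x y)

theorem exists_correlation_recursion (hd0 : 0 < d) (hd1 : d ≤ 1)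
    (hν : IsMarkovMeasure (latticeMatrix d) ν) (hM : MarkovAtPairs d ν) :
    ∃ a : ℝ, 0 ≤ a ∧ a ≤ 1 ∧ ∀ k : ℕ,
      ν.real ({b | b 0 = 1} ∩ {b | b (k + 1 : ℕ) = 1}) - d ^ 2 =
        -a * (ν.real ({b | b 0 = 1} ∩ {b | b k = 1}) - d ^ 2) := by
  have := hν.isProbabilityMeasure
  obtain ⟨a, h0, h1, ha⟩ := exists_latticeMatrix_contraction hd0 hd1
  refine ⟨a, h0, h1, fun k => ?_⟩
  have e1 : ν.real ({b | b 0 = 1} ∩ {b | b k = 0}) =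
      d - ν.real ({b | b 0 = 1} ∩ {b | b k = 1}) := by
    have := congrArg ENNReal.toReal (measure_inter_zero_add_inter_one (ν := ν) {b | b 0 = 1} k)
    rw [ENNReal.toReal_add (measure_ne_top _ _) (measure_ne_top _ _), measure_one hd0 hd1 hν,
      ENNReal.toReal_ofReal hd0.le] at this
    simp only [measureReal_def]
    linarith
  have e2 := congrArg ENNReal.toReal
    (measure_inter_zero_add_inter_one (ν := ν) ({b | b 0 = 1} ∩ {b | b (k + 1) = 1}) k)
  rw [Set.inter_right_comm, Set.inter_right_comm _ _ {b : ℤ → Fin 2 | b k = 1}, hM, hM,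
    ENNReal.toReal_add (ENNReal.mul_ne_top (measure_ne_top _ _) ENNReal.ofReal_ne_top)
      (ENNReal.mul_ne_top (measure_ne_top _ _) ENNReal.ofReal_ne_top), ENNReal.toReal_mul,
      ENNReal.toReal_mul, ENNReal.toReal_ofReal (latticeMatrix_nonneg hd0 hd1 _ _),
      ENNReal.toReal_ofReal (latticeMatrix_nonneg hd0 hd1 _ _), ← measureReal_def,
      ← measureReal_def, ← measureReal_def, e1, ha] at e2
  push_cast
  rw [← e2]
  ring

theorem ae_tendsto_forward_density (hd0 : 0 < d) (hd1 : d ≤ 1)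
    (hν : IsMarkovMeasure (latticeMatrix d) ν) (hM : MarkovAtPairs d ν) :
    ∀ᵐ b ∂ν, Tendsto (fun n : ℕ =>
      (∑ i ∈ Finset.range n, if b i = 1 then (1 : ℝ) else 0) / n) atTop (𝓝 d) := by
  have := hν.isProbabilityMeasure
  obtain ⟨a, h0, h1, ha⟩ := exists_correlation_recursion hd0 hd1 hν hM
  have key := ae_tendsto_card_div (P := ν) (A := fun k : ℕ => {b : ℤ → Fin 2 | b k = 1})
    (fun n => measurableSet_site _ _) h0 h1 hd0.le hd1
    (fun n => by rw [measureReal_def, measure_one hd0 hd1 hν, ENNReal.toReal_ofReal hd0.le])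
    (c := fun k => ν.real ({b | b 0 = 1} ∩ {b | b k = 1})) (fun j k => by
      have := measure_shift hν j ((measurableSet_site 0 1).inter (measurableSet_site k 1))
      simp only [measureReal_def]
      rw [← this]
      simp [Set.inter_def]) ha
  simpa [Set.indicator_apply] using key

theorem ae_tendsto_backward_density (hd0 : 0 < d) (hd1 : d ≤ 1)
    (hν : IsMarkovMeasure (latticeMatrix d) ν) (hM : MarkovAtPairs d ν) :
    ∀ᵐ b ∂ν, Tendsto (fun n : ℕ =>
      (∑ i ∈ Finset.range n, if b (-1 - i) = 1 then (1 : ℝ) else 0) / n) atTop (𝓝 d) := by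
  have := hν.isProbabilityMeasure
  obtain ⟨a, h0, h1, ha⟩ := exists_correlation_recursion hd0 hd1 hν hM
  have key := ae_tendsto_card_div (P := ν) (A := fun k : ℕ => {b : ℤ → Fin 2 | b (-1 - k) = 1})
    (fun n => measurableSet_site _ _) h0 h1 hd0.le hd1
    (fun n => by rw [measureReal_def, measure_one hd0 hd1 hν, ENNReal.toReal_ofReal hd0.le])
    (c := fun k => ν.real ({b | b 0 = 1} ∩ {b | b k = 1})) (fun j k => by
      have := measure_shift hν (-1 - (j + k))
        ((measurableSet_site 0 1).inter (measurableSet_site k 1))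
      simp only [measureReal_def]
      rw [← this]
      congr 2
      ext b
      have e : -1 - ((j : ℤ) + k) + k = -1 - j := by ring
      simp [e, and_comm]) ha
  simpa [Set.indicator_apply] using key

/-- At most half of the sites are occupied: no two neighbouring sites are. -/
theorem ae_no_adjacent_ones (hν : IsMarkovMeasure (latticeMatrix d) ν) (hd : d ≤ 1 / 2) :
    ∀ᵐ b ∂ν, ∀ n, ¬(b n = 1 ∧ b (n + 1) = 1) := by
  refine ae_all_iff.2 fun n => ?_
  rw [ae_iff]
  have h := measure_shift hν n ((measurableSet_site 0 1).inter (measurableSet_site 1 1))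
  rw [measure_pair hν] at h
  simp only [latticeMatrix, if_pos hd] at h
  simpa [Set.inter_def] using h

/-- More than half of the sites are occupied: no two neighbouring sites are empty. -/
theorem ae_no_adjacent_zeros (hν : IsMarkovMeasure (latticeMatrix d) ν) (hd : ¬d ≤ 1 / 2) :
    ∀ᵐ b ∂ν, ∀ n, ¬(b n = 0 ∧ b (n + 1) = 0) := by
  refine ae_all_iff.2 fun n => ?_
  rw [ae_iff]
  have h := measure_shift hν n ((measurableSet_site 0 0).inter (measurableSet_site 1 0))
  rw [measure_pair hν] at h
  simp only [latticeMatrix, if_neg hd] at h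
  simpa [Set.inter_def] using h

end Markov

/-! ### Enumerating the ones of a binary sequence -/

/-- There are infinitely many ones in both directions. -/
def IsRich (b : ℤ → Fin 2) : Prop :=
  ∀ n : ℤ, (∃ k : ℕ, b (n + k) = 1) ∧ ∃ k : ℕ, b (n - k) = 1

section Enumeration

variable {b : ℤ → Fin 2}

theorem lt_nextOne (b : ℤ → Fin 2) (n : ℤ) : n < nextOne b n := by
  unfold nextOne; omega

theorem prevOne_lt (b : ℤ → Fin 2) (n : ℤ) : prevOne b n < n := by
  unfold prevOne; omega

theorem IsRich.nextOne_eq_one (hb : IsRich b) (n : ℤ) : b (nextOne b n) = 1 :=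
  Nat.sInf_mem (s := {k : ℕ | b (n + 1 + k) = 1}) (hb (n + 1)).1

theorem IsRich.prevOne_eq_one (hb : IsRich b) (n : ℤ) : b (prevOne b n) = 1 :=
  Nat.sInf_mem (s := {k : ℕ | b (n - 1 - k) = 1}) (hb (n - 1)).2

theorem ne_one_of_lt_nextOne {n m : ℤ} (h : n < m) (h' : m < nextOne b n) : b m ≠ 1 := by
  obtain ⟨k, rfl⟩ : ∃ k : ℕ, m = n + 1 + k := ⟨(m - n - 1).toNat, by omega⟩
  have hk : k < sInf {k : ℕ | b (n + 1 + k) = 1} := by unfold nextOne at h'; omega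
  exact Nat.notMem_of_lt_sInf hk

theorem nextOne_eq_of_forall {n m : ℤ} (h : n < m) (hm : b m = 1)
    (hne : ∀ k, n < k → k < m → b k ≠ 1) : nextOne b n = m := by
  obtain ⟨k, rfl⟩ : ∃ k : ℕ, m = n + 1 + k := ⟨(m - n - 1).toNat, by omega⟩
  have hk : sInf {k : ℕ | b (n + 1 + k) = 1} = k := by
    refine le_antisymm (Nat.sInf_le hm) (le_csInf ⟨k, hm⟩ fun j hj => ?_)
    by_contra hjk
    exact hne (n + 1 + j) (by omega) (by omega) hj
  rw [nextOne, hk]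

theorem prevOne_eq_of_forall {n m : ℤ} (h : m < n) (hm : b m = 1)
    (hne : ∀ k, m < k → k < n → b k ≠ 1) : prevOne b n = m := by
  obtain ⟨k, rfl⟩ : ∃ k : ℕ, m = n - 1 - k := ⟨(n - m - 1).toNat, by omega⟩
  have hk : sInf {k : ℕ | b (n - 1 - k) = 1} = k := by
    refine le_antisymm (Nat.sInf_le hm) (le_csInf ⟨k, hm⟩ fun j hj => ?_)
    by_contra hjk
    exact hne (n - 1 - j) (by omega) (by omega) hj
  rw [prevOne, hk]

theorem ne_one_of_prevOne_lt {n m : ℤ} (h : prevOne b n < m) (h' : m < n) : b m ≠ 1 := by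
  obtain ⟨k, rfl⟩ : ∃ k : ℕ, m = n - 1 - k := ⟨(n - m - 1).toNat, by omega⟩
  have hk : k < sInf {k : ℕ | b (n - 1 - k) = 1} := by unfold prevOne at h; omega
  exact Nat.notMem_of_lt_sInf hk

theorem prevOne_nextOne {n : ℤ} (hn : b n = 1) : prevOne b (nextOne b n) = n :=
  prevOne_eq_of_forall (lt_nextOne b n) hn fun _ => ne_one_of_lt_nextOne

theorem nextOne_prevOne {n : ℤ} (hn : b n = 1) : nextOne b (prevOne b n) = n :=
  nextOne_eq_of_forall (prevOne_lt b n) hn fun _ => ne_one_of_prevOne_lt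

theorem nextOne_shift (b : ℤ → Fin 2) (m n : ℤ) :
    m + nextOne (fun i => b (m + i)) n = nextOne b (m + n) := by
  simp only [nextOne, add_assoc]

theorem prevOne_shift (b : ℤ → Fin 2) (m n : ℤ) :
    m + prevOne (fun i => b (m + i)) n = prevOne b (m + n) := by
  simp only [prevOne, add_sub_assoc]

theorem onePosition_zero (b : ℤ → Fin 2) (n : ℤ) : onePosition b n 0 = n := rfl

theorem onePosition_shift (b : ℤ → Fin 2) (m n i : ℤ) :
    m + onePosition (fun i => b (m + i)) n i = onePosition b (m + n) i := by
  rcases i with k | k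
  · change m + (nextOne (fun i => b (m + i)))^[k] n = (nextOne b)^[k] (m + n)
    induction k generalizing n with
    | zero => rfl
    | succ k ih => rw [Function.iterate_succ_apply, Function.iterate_succ_apply, ih, nextOne_shift]
  · change m + (prevOne (fun i => b (m + i)))^[k + 1] n = (prevOne b)^[k + 1] (m + n)
    induction k generalizing n with
    | zero => exact prevOne_shift b m n
    | succ k ih =>
      rw [Function.iterate_succ_apply _ (k + 1), Function.iterate_succ_apply _ (k + 1), ih,
        prevOne_shift]

theorem onePosition_succ_of_nonneg (b : ℤ → Fin 2) (n : ℤ) (k : ℕ) :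
    onePosition b n (k + 1 : ℤ) = nextOne b (onePosition b n k) :=
  Function.iterate_succ_apply' (nextOne b) k n

theorem onePosition_pred_of_nonpos (b : ℤ → Fin 2) (n : ℤ) (k : ℕ) :
    onePosition b n (-k - 1 : ℤ) = prevOne b (onePosition b n (-k)) := by
  have e : (-k - 1 : ℤ) = Int.negSucc k := by omega
  rcases k with _ | k
  · rfl
  · rw [e]
    exact Function.iterate_succ_apply' (prevOne b) (k + 1) n

theorem IsRich.onePosition_eq_one (hb : IsRich b) {n : ℤ} (hn : b n = 1) (i : ℤ) :
    b (onePosition b n i) = 1 := by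
  induction i with
  | zero => exact hn
  | succ k _ => rw [onePosition_succ_of_nonneg]; exact hb.nextOne_eq_one _
  | pred k _ => rw [onePosition_pred_of_nonpos]; exact hb.prevOne_eq_one _

theorem IsRich.onePosition_succ (hb : IsRich b) {n : ℤ} (hn : b n = 1) (i : ℤ) :
    onePosition b n (i + 1) = nextOne b (onePosition b n i) := by
  rcases le_or_gt 0 i with h | h
  · lift i to ℕ using h
    exact onePosition_succ_of_nonneg b n i
  · obtain ⟨k, rfl⟩ : ∃ k : ℕ, i = -k - 1 := ⟨(-i - 1).toNat, by omega⟩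
    rw [onePosition_pred_of_nonpos, sub_add_cancel, nextOne_prevOne (hb.onePosition_eq_one hn _)]

/-- Counting from the next particle shifts the labels by one. -/
theorem IsRich.onePosition_nextOne (hb : IsRich b) {n : ℤ} (hn : b n = 1) (i : ℤ) :
    onePosition b (nextOne b n) i = onePosition b n (i + 1) := by
  have hn' := hb.nextOne_eq_one n
  induction i with
  | zero => rw [zero_add]; exact (onePosition_succ_of_nonneg b n 0).symm
  | succ k ih => rw [hb.onePosition_succ hn', ih, ← hb.onePosition_succ hn]
  | pred k ih =>
    have h1 := hb.onePosition_succ hn' (-k - 1)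
    have h2 := hb.onePosition_succ hn (-k)
    rw [sub_add_cancel] at h1
    rw [sub_add_cancel, ← prevOne_nextOne (hb.onePosition_eq_one hn' (-k - 1)), ← h1, ih, h2,
      prevOne_nextOne (hb.onePosition_eq_one hn _)]

end Enumeration

/-! ### The density of the particles of a binary sequence -/

/-- The number of ones in `[0, m)` if `0 ≤ m`, and minus the number of ones in `[m, 0)` if
`m < 0`. -/
def signedCount (b : ℤ → Fin 2) : ℤ → ℤ
  | Int.ofNat k => ∑ i ∈ Finset.range k, if b i = 1 then 1 else 0
  | Int.negSucc k => -∑ i ∈ Finset.range (k + 1), if b (-1 - i) = 1 then 1 else 0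

/-- The ones of `b` have density `d` in both directions. -/
def HasLatticeDensity (b : ℤ → Fin 2) (d : ℝ) : Prop :=
  Tendsto (fun n : ℕ => (∑ i ∈ Finset.range n, if b i = 1 then (1 : ℝ) else 0) / n) atTop (𝓝 d) ∧
  Tendsto (fun n : ℕ => (∑ i ∈ Finset.range n, if b (-1 - i) = 1 then (1 : ℝ) else 0) / n)
    atTop (𝓝 d)

section Density

variable {b : ℤ → Fin 2} {d : ℝ}

theorem signedCount_neg (b : ℤ → Fin 2) (k : ℕ) :
    signedCount b (-k) = -∑ i ∈ Finset.range k, if b (-1 - i) = 1 then 1 else 0 := by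
  rcases k with _ | k
  · rfl
  · rfl

theorem signedCount_succ (b : ℤ → Fin 2) (m : ℤ) :
    signedCount b (m + 1) = signedCount b m + if b m = 1 then 1 else 0 := by
  rcases le_or_gt 0 m with h | h
  · lift m to ℕ using h
    exact Finset.sum_range_succ _ _
  · obtain ⟨k, rfl⟩ : ∃ k : ℕ, m = -(k + 1 : ℕ) := ⟨(-m - 1).toNat, by omega⟩
    have e : (-(k + 1 : ℕ) + 1 : ℤ) = -k := by push_cast; ring
    have e' : (-1 - k : ℤ) = -(k + 1 : ℕ) := by push_cast; ring
    rw [e, signedCount_neg, signedCount_neg, Finset.sum_range_succ, e']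
    ring

theorem signedCount_eq_of_forall {n : ℤ} (k : ℕ) (h : ∀ m, n ≤ m → m < n + k → b m ≠ 1) :
    signedCount b (n + k) = signedCount b n := by
  induction k with
  | zero => simp
  | succ k ih =>
    have := ih fun m h1 h2 => h m h1 (by push_cast; omega)
    push_cast
    rw [← add_assoc, signedCount_succ, this, if_neg (h _ (by omega) (by push_cast; omega)),
      add_zero]

theorem HasLatticeDensity.tendsto_signedCount_atTop (h : HasLatticeDensity b d) :
    Tendsto (fun m : ℤ => (signedCount b m : ℝ) / m) atTop (𝓝 d) := by
  rw [← Nat.map_cast_int_atTop, tendsto_map'_iff]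
  refine h.1.congr fun n => ?_
  have : signedCount b n = ∑ i ∈ Finset.range n, if b i = 1 then 1 else 0 := rfl
  simp [this]

theorem HasLatticeDensity.tendsto_signedCount_atBot (h : HasLatticeDensity b d) :
    Tendsto (fun m : ℤ => (signedCount b m : ℝ) / m) atBot (𝓝 d) := by
  have h1 : Tendsto (fun m : ℤ => (signedCount b (-m) : ℝ) / (-m : ℤ)) atTop (𝓝 d) := by
    rw [← Nat.map_cast_int_atTop, tendsto_map'_iff]
    refine h.2.congr fun n => ?_
    simp [signedCount_neg, neg_div_neg_eq]
  refine (h1.comp tendsto_neg_atBot_atTop).congr fun m => ?_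
  simp

theorem HasLatticeDensity.isRich (h : HasLatticeDensity b d) (hd : 0 < d) : IsRich b := by
  intro n
  constructor
  · by_contra! hne
    have h1 : ∀ k : ℕ, signedCount b (n + k) = signedCount b n := fun k =>
      signedCount_eq_of_forall k fun m h1 h2 => by
        obtain ⟨j, rfl⟩ : ∃ j : ℕ, m = n + j := ⟨(m - n).toNat, by omega⟩
        exact hne j
    have h2 : Tendsto (fun m : ℤ => (signedCount b m : ℝ) / m) atTop (𝓝 0) := by
      have h3 : Tendsto (fun m : ℤ => (signedCount b n : ℝ) / m) atTop (𝓝 0) :=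
        tendsto_const_nhds.div_atTop tendsto_intCast_atTop_atTop
      refine h3.congr' ?_
      filter_upwards [eventually_ge_atTop n] with m hm
      obtain ⟨j, rfl⟩ : ∃ j : ℕ, m = n + j := ⟨(m - n).toNat, by omega⟩
      rw [h1]
    exact hd.ne' (tendsto_nhds_unique h.tendsto_signedCount_atTop h2)
  · by_contra! hne
    have h1 : ∀ k : ℕ, signedCount b (n - k) = signedCount b n := fun k => by
      have := signedCount_eq_of_forall (b := b) (n := n - k) k fun m h1 h2 => by
        obtain ⟨j, rfl⟩ : ∃ j : ℕ, m = n - j := ⟨(n - m).toNat, by omega⟩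
        exact hne j
      rw [← this, sub_add_cancel]
    have h2 : Tendsto (fun m : ℤ => (signedCount b m : ℝ) / m) atBot (𝓝 0) := by
      have h3 : Tendsto (fun m : ℤ => (signedCount b n : ℝ) / m) atBot (𝓝 0) :=
        tendsto_const_nhds.div_atBot (tendsto_intCast_atBot_iff.2 tendsto_id)
      refine h3.congr' ?_
      filter_upwards [eventually_le_atBot n] with m hm
      obtain ⟨j, rfl⟩ : ∃ j : ℕ, m = n - j := ⟨(n - m).toNat, by omega⟩
      rw [h1]
    exact hd.ne' (tendsto_nhds_unique h.tendsto_signedCount_atBot h2)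

theorem signedCount_nextOne {n : ℤ} (hn : b n = 1) :
    signedCount b (nextOne b n) = signedCount b n + 1 := by
  have h := lt_nextOne b n
  obtain ⟨k, hk⟩ : ∃ k : ℕ, nextOne b n = n + 1 + k := ⟨(nextOne b n - n - 1).toNat, by omega⟩
  rw [hk, signedCount_eq_of_forall k fun m h1 h2 => ne_one_of_lt_nextOne (by omega) (hk ▸ h2),
    signedCount_succ, if_pos hn]

theorem IsRich.signedCount_onePosition (hb : IsRich b) (h0 : b 0 = 1) (i : ℤ) :
    signedCount b (onePosition b 0 i) = i := by
  have hs : ∀ i, signedCount b (onePosition b 0 (i + 1)) =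
      signedCount b (onePosition b 0 i) + 1 := fun i => by
    rw [hb.onePosition_succ h0, signedCount_nextOne (hb.onePosition_eq_one h0 i)]
  induction i with
  | zero => rfl
  | succ k ih => rw [hs, ih]
  | pred k ih =>
    have := hs (-k - 1)
    rw [sub_add_cancel, ih] at this
    omega

theorem le_onePosition (b : ℤ → Fin 2) {i : ℤ} (hi : 0 ≤ i) : i ≤ onePosition b 0 i := by
  lift i to ℕ using hi
  induction i with
  | zero => rfl
  | succ k ih =>
    have := onePosition_step b 0 k
    push_cast
    omega

theorem onePosition_le (b : ℤ → Fin 2) {i : ℤ} (hi : i ≤ 0) : onePosition b 0 i ≤ i := by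
  obtain ⟨k, rfl⟩ : ∃ k : ℕ, i = -k := ⟨(-i).toNat, by omega⟩
  induction k with
  | zero => rfl
  | succ k ih =>
    have h := onePosition_step b 0 (-(k + 1 : ℕ))
    have e : (-(k + 1 : ℕ) + 1 : ℤ) = -k := by push_cast; ring
    rw [e] at h
    have := ih (by omega)
    push_cast at h ⊢
    omega

/-- The `i`-th particle has the position `i / d` up to lower order terms: the number of ones up to
the `i`-th one is `i`. -/
theorem HasLatticeDensity.tendsto_onePosition (h : HasLatticeDensity b d) (hd : 0 < d)
    (h0 : b 0 = 1) :
    Tendsto (fun i : ℤ => (onePosition b 0 i : ℝ) / i) atTop (𝓝 d⁻¹) ∧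
      Tendsto (fun i : ℤ => (onePosition b 0 i : ℝ) / i) atBot (𝓝 d⁻¹) := by
  have hb := h.isRich hd
  have h1 : Tendsto (onePosition b 0) atTop atTop :=
    tendsto_atTop_mono' _ ((eventually_ge_atTop 0).mono fun i hi => le_onePosition b hi) tendsto_id
  have h2 : Tendsto (onePosition b 0) atBot atBot :=
    tendsto_atBot_mono' _ ((eventually_le_atBot 0).mono fun i hi => onePosition_le b hi) tendsto_id
  constructor
  · refine ((h.tendsto_signedCount_atTop.comp h1).inv₀ hd.ne').congr fun i => ?_
    simp [hb.signedCount_onePosition h0]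
  · refine ((h.tendsto_signedCount_atBot.comp h2).inv₀ hd.ne').congr fun i => ?_
    simp [hb.signedCount_onePosition h0]

end Density

theorem ae_hasLatticeDensity {d : ℝ} {ν : Measure (ℤ → Fin 2)} (hd0 : 0 < d) (hd1 : d ≤ 1)
    (hν : IsMarkovMeasure (latticeMatrix d) ν) (hM : MarkovAtPairs d ν) :
    ∀ᵐ b ∂ν, HasLatticeDensity b d :=
  (ae_tendsto_forward_density hd0 hd1 hν hM).and (ae_tendsto_backward_density hd0 hd1 hν hM)

/-! ### Measurability -/

theorem measurable_sInf_nat {α : Type*} [MeasurableSpace α] {p : ℕ → α → Prop}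
    (hp : ∀ k, MeasurableSet {a | p k a}) : Measurable fun a => sInf {k | p k a} := by
  refine measurable_to_countable' fun j => ?_
  have e : (fun a => sInf {k | p k a}) ⁻¹' {j} =
      ({a | p j a} ∩ ⋂ i : ℕ, ⋂ _ : i < j, {a | p i a}ᶜ) ∪
        ({_a | j = 0} ∩ ⋂ i : ℕ, {a | p i a}ᶜ) := by
    ext a
    simp only [Set.mem_preimage, Set.mem_singleton_iff, Set.mem_union, Set.mem_inter_iff,
      Set.mem_ofPred_eq, Set.mem_iInter, Set.mem_compl_iff]
    constructor
    · rintro rfl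
      by_cases h : ∃ k, p k a
      · exact Or.inl ⟨Nat.sInf_mem (s := {k | p k a}) h, fun i hi => Nat.notMem_of_lt_sInf hi⟩
      · push Not at h
        refine Or.inr ⟨?_, h⟩
        simp [h]
    · rintro (⟨h, h'⟩ | ⟨rfl, h⟩)
      · refine le_antisymm (Nat.sInf_le h) (le_csInf ⟨j, h⟩ fun i hi => ?_)
        by_contra hij
        exact h' i (by omega) hi
      · simp [h]
  rw [e]
  exact ((hp j).inter (MeasurableSet.iInter fun i => MeasurableSet.iInter fun _ =>
    (hp i).compl)).union
    ((MeasurableSet.const _).inter (MeasurableSet.iInter fun i => (hp i).compl))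

theorem measurable_nextOne (n : ℤ) : Measurable fun b => nextOne b n :=
  (measurable_from_top.comp
    (measurable_sInf_nat fun k => measurableSet_site (n + 1 + k) 1)).const_add (n + 1)

theorem measurable_prevOne (n : ℤ) : Measurable fun b => prevOne b n :=
  (measurable_from_top.comp
    (measurable_sInf_nat fun k => measurableSet_site (n - 1 - k) 1)).const_sub (n - 1)

theorem measurable_apply_of_countable {α β γ : Type*} [MeasurableSpace α] [MeasurableSpace β]
    [MeasurableSpace γ] [Countable β] [MeasurableSingletonClass β] {f : α → β → γ} {g : α → β}
    (hf : ∀ y, Measurable fun a => f a y) (hg : Measurable g) : Measurable fun a => f a (g a) :=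
  (measurable_from_prod_countable_left (f := fun p : α × β => f p.1 p.2) hf).comp
    (measurable_id.prodMk hg)

theorem measurable_iterate_of_countable {α β : Type*} [MeasurableSpace α] [MeasurableSpace β]
    [Countable β] [MeasurableSingletonClass β] {f : α → β → β}
    (hf : ∀ y, Measurable fun a => f a y) (k : ℕ) (y : β) : Measurable fun a => (f a)^[k] y := by
  induction k with
  | zero => exact measurable_const
  | succ k ih =>
    simp only [Function.iterate_succ_apply']
    exact measurable_apply_of_countable hf ih

theorem measurable_onePosition (n i : ℤ) : Measurable fun b => onePosition b n i := by
  rcases i with k | k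
  · exact measurable_iterate_of_countable measurable_nextOne k n
  · exact measurable_iterate_of_countable measurable_prevOne (k + 1) n

section LabelledConfig

variable {r : ℝ}

theorem measurable_position (i : ℤ) : Measurable fun x : LabelledConfig r => x.1 i :=
  (measurable_pi_apply i).comp measurable_subtype_coe

theorem measurable_labelledConfig {α : Type*} [MeasurableSpace α] {f : α → LabelledConfig r}
    (h : ∀ i, Measurable fun a => (f a).1 i) : Measurable f :=
  (measurable_pi_iff.2 h).subtype_mk (h := fun a => (f a).2)

theorem measurable_latticeConfig (n : ℤ) : Measurable fun b => latticeConfig b n :=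
  measurable_labelledConfig fun i =>
    (measurable_of_countable fun k : ℤ => (k : ℝ)).comp (measurable_onePosition n i)

theorem measurable_changeRadius (r' : ℝ) : Measurable (changeRadius (r := r) r') :=
  measurable_labelledConfig fun i => (measurable_position i).sub_const _

theorem measurable_rescale {v : ℝ} (hv : 0 < v) :
    Measurable fun p : ℝ × LabelledConfig (r / v) => rescale hv r p.1 p.2 :=
  measurable_labelledConfig fun i =>
    (((measurable_position i).comp measurable_snd).const_mul v).add measurable_fst

theorem measurable_labelledMap {v : ℝ} (hv : 0 < v) : Measurable (labelledMap hv r) :=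
  measurable_labelledConfig fun i =>
    ((measurable_position i).add_const v).min ((measurable_position (i + 1)).sub_const _)

theorem measurable_forget : Measurable (forget (r := r)) := measurable_quotient_mk''

theorem measurableSet_config_iff {A : Set (Config r)} :
    MeasurableSet A ↔ MeasurableSet (forget ⁻¹' A) :=
  measurableSet_quotient

theorem measurable_trafficMap {v : ℝ} (hv : 0 < v) : Measurable (trafficMap hv r) :=
  measurable_from_quotient.2 (measurable_forget.comp (measurable_labelledMap hv))

/-- The configuration moved by `s`. -/
noncomputable def translate (s : ℝ) (x : LabelledConfig r) : LabelledConfig r :=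
  ⟨fun i => x.1 i + s, fun i => by linarith [x.2 i]⟩

theorem measurable_translate (s : ℝ) : Measurable (translate (r := r) s) :=
  measurable_labelledConfig fun i => (measurable_position i).add_const s

/-- The configuration with the labels shifted by `k`. -/
def relabel (k : ℤ) (x : LabelledConfig r) : LabelledConfig r :=
  ⟨fun i => x.1 (i + k), fun i => by simpa only [add_right_comm] using x.2 (i + k)⟩

theorem measurable_relabel (k : ℤ) : Measurable (relabel (r := r) k) :=
  measurable_labelledConfig fun i => measurable_position (i + k)

theorem forget_relabel (k : ℤ) (x : LabelledConfig r) : forget (relabel k x) = forget x :=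
  Quotient.sound ⟨-k, fun i => by simp [relabel]⟩

theorem position_monotone (hr : 0 ≤ r) (x : LabelledConfig r) : Monotone x.1 :=
  monotone_int_of_le_succ fun i => by linarith [x.2 i]

end LabelledConfig

/-! ### The labelled measure as a translation invariant marked process -/

/-- The configuration of balls of radius `r` obtained from the ones of `b` by stretching the empty
sites to the length `v` and the occupied sites to the length `2 r`, with the particle `0` at `z`
when `b 0 = 1`. -/
noncomputable def placed {v : ℝ} (hv : 0 < v) (r : ℝ) (b : ℤ → Fin 2) (z : ℝ) : LabelledConfig r :=
  ⟨fun i => v * (onePosition b 0 i - i) + 2 * r * i + z, fun i => by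
    have h : ((onePosition b 0 i + 1 : ℤ) : ℝ) ≤ (onePosition b 0 (i + 1) : ℝ) :=
      Int.cast_le.mpr (onePosition_step b 0 i)
    push_cast at h ⊢
    nlinarith⟩

section Placed

variable {v : ℝ} (hv : 0 < v) (r : ℝ)

theorem placed_zero (b : ℤ → Fin 2) (z : ℝ) : (placed hv r b z).1 0 = z := by
  simp [placed, onePosition_zero]

theorem placed_one (b : ℤ → Fin 2) (z : ℝ) :
    (placed hv r b z).1 1 = v * (nextOne b 0 - 1) + 2 * r + z := by
  have : onePosition b 0 1 = nextOne b 0 := onePosition_succ_of_nonneg b 0 0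
  simp [placed, this]

theorem measurable_placed : Measurable fun p : (ℤ → Fin 2) × ℝ => placed hv r p.1 p.2 := by
  refine measurable_labelledConfig fun i => ?_
  have h : Measurable fun b : ℤ → Fin 2 => (onePosition b 0 i : ℝ) :=
    (measurable_of_countable fun k : ℤ => (k : ℝ)).comp (measurable_onePosition 0 i)
  exact ((((h.comp measurable_fst).sub_const _).const_mul v).add_const _).add measurable_snd

theorem measurable_placed_left (z : ℝ) : Measurable fun b : ℤ → Fin 2 => placed hv r b z :=
  measurable_labelledConfig fun i => ((((measurable_of_countable fun k : ℤ => (k : ℝ)).comp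
    (measurable_onePosition 0 i)).sub_const _).const_mul v).add_const _ |>.add_const z

theorem rescale_changeRadius_latticeConfig (b : ℤ → Fin 2) (n : ℤ) (w : ℝ) :
    rescale hv r w (changeRadius (r / v) (latticeConfig b n)) =
      placed hv r (fun i => b (n + i)) (n * v + w) := by
  refine Subtype.ext (funext fun i => ?_)
  have h := onePosition_shift b n 0 i
  rw [add_zero] at h
  simp only [rescale, changeRadius, latticeConfig, placed, ← h]
  push_cast
  field_simp
  ring

theorem tsum_setLIntegral_Ico {v : ℝ} (hv : 0 < v) (f : ℝ → ENNReal) :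
    ∑' n : ℤ, ∫⁻ w in Set.Ico 0 v, f (n * v + w) = ∫⁻ z, f z := by
  have h : ∀ n : ℤ, ∫⁻ w in Set.Ico 0 v, f (n * v + w) =
      ∫⁻ z in Set.Ico (n • v) ((n + 1) • v), f z := by
    intro n
    have hp := (measurePreserving_add_left (volume : Measure ℝ)
      (n * v)).setLIntegral_comp_preimage_emb
      (measurableEmbedding_addLeft _) f (Set.Ico (n • v) ((n + 1) • v))
    rw [← hp]
    congr 2
    ext w
    simp [add_mul]
  simp_rw [h]
  rw [← lintegral_iUnion (fun _ => measurableSet_Ico) (Set.pairwise_disjoint_Ico_zsmul v),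
    iUnion_Ico_zsmul hv, setLIntegral_univ]

/-- The particle `0` has the Lebesgue measure, up to the factor `1 / v`, as its law, and the rest of
the configuration is attached to it according to `ν` restricted to the sequences with a one at the
origin. -/
theorem lintegral_labelledMeasure {d : ℝ} {ν : Measure (ℤ → Fin 2)}
    (hν : IsMarkovMeasure (latticeMatrix d) ν) {f : LabelledConfig r → ENNReal}
    (hf : Measurable f) :
    ∫⁻ x, f x ∂labelledMeasure hv r ν =
      (ENNReal.ofReal v)⁻¹ * ∫⁻ b in {b | b 0 = 1}, (∫⁻ z, f (placed hv r b z)) ∂ν := by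
  have := hν.isProbabilityMeasure
  have hsf : SFinite (latticeLift ν) := by unfold latticeLift; infer_instance
  have hg : Measurable fun p : ℝ × LabelledConfig (r / v) => f (rescale hv r p.1 p.2) :=
    hf.comp (measurable_rescale hv)
  have hF : Measurable fun p : (ℤ → Fin 2) × ℝ => f (placed hv r p.1 p.2) :=
    hf.comp (measurable_placed hv r)
  have inner : ∀ w : ℝ, ∫⁻ y, f (rescale hv r w y) ∂((latticeLift ν).map (changeRadius (r / v))) =
      ∑' n : ℤ, ∫⁻ b in {b | b 0 = 1}, f (placed hv r b (n * v + w)) ∂ν := by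
    intro w
    have hgw : Measurable fun y => f (rescale hv r w y) := hg.comp measurable_prodMk_left
    rw [lintegral_map hgw (measurable_changeRadius _), latticeLift, lintegral_sum_measure]
    refine tsum_congr fun n => ?_
    have hgc : Measurable fun y : LabelledConfig (1 / 2) =>
        f (rescale hv r w (changeRadius (r / v) y)) :=
      hgw.comp (measurable_changeRadius _)
    rw [lintegral_map hgc (measurable_latticeConfig n)]
    simp only [rescale_changeRadius_latticeConfig]
    have hset : (fun (b : ℤ → Fin 2) i => b (n + i)) ⁻¹' {b | b 0 = 1} = {b | b n = 1} := by
      ext b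
      simp
    rw [← hset]
    have hFw : Measurable fun b => f (placed hv r b (n * v + w)) :=
      hf.comp (measurable_placed_left hv r _)
    exact (measurePreserving_shift hν n).setLIntegral_comp_preimage (measurableSet_site 0 1) hFw
  rw [labelledMeasure, lintegral_map hf (measurable_rescale hv), lintegral_prod _ hg.aemeasurable]
  simp_rw [inner]
  rw [ProbabilityTheory.cond, lintegral_smul_measure, Real.volume_Ico, sub_zero, smul_eq_mul]
  congr 1
  have hG : Measurable fun z => ∫⁻ b in {b | b 0 = 1}, f (placed hv r b z) ∂ν :=
    hF.lintegral_prod_left'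
  have hGn : ∀ n : ℤ, Measurable fun w => ∫⁻ b in {b | b 0 = 1}, f (placed hv r b (n * v + w)) ∂ν :=
    fun n => hG.comp (measurable_const_add _)
  rw [lintegral_tsum fun n => (hGn n).aemeasurable,
    tsum_setLIntegral_Ico hv fun z => ∫⁻ b in {b | b 0 = 1}, f (placed hv r b z) ∂ν]
  exact lintegral_lintegral_swap (hF.comp measurable_swap).aemeasurable

end Placed

/-! ### Mass transport on the lattice -/

section LatticeMassTransport

variable {d : ℝ} {ν : Measure (ℤ → Fin 2)}

/-- The expected mass sent out by the origin equals the expected mass that it receives, if the mass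
sent from `n` to `n + m` is `h` of the sequence seen from `n`. -/
theorem lintegral_tsum_shift (hν : IsMarkovMeasure (latticeMatrix d) ν)
    {h : (ℤ → Fin 2) → ℤ → ENNReal} (hh : ∀ m, Measurable fun b => h b m) :
    ∫⁻ b, ∑' m : ℤ, h b m ∂ν = ∫⁻ b, ∑' m : ℤ, h (fun i => b (-m + i)) m ∂ν := by
  have hh' : ∀ m : ℤ, Measurable fun b : ℤ → Fin 2 => h (fun i => b (-m + i)) m := fun m =>
    (hh m).comp (measurePreserving_shift hν (-m)).measurable
  rw [lintegral_tsum fun m => (hh m).aemeasurable, lintegral_tsum fun m => (hh' m).aemeasurable]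
  refine tsum_congr fun m => ?_
  exact ((measurePreserving_shift hν (-m)).lintegral_comp (hh m)).symm

theorem nextOne_shift_neg (b : ℤ → Fin 2) (m : ℤ) :
    nextOne (fun i => b (-m + i)) 0 = m + nextOne b (-m) := by
  have := nextOne_shift b (-m) 0
  rw [add_zero] at this
  omega

/-- Kac's formula: the mean distance to the next particle, on the event that the origin is occupied,
is one. -/
theorem lintegral_nextOne (hν : IsMarkovMeasure (latticeMatrix d) ν) (hrich : ∀ᵐ b ∂ν, IsRich b) :
    ∫⁻ b in {b | b 0 = 1}, ENNReal.ofReal (nextOne b 0) ∂ν = 1 := by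
  classical
  have := hν.isProbabilityMeasure
  -- Every particle sends unit mass to each site from its own up to the next particle, exclusive; so
  -- every site receives unit mass, from the last particle at or before it.
  set h : (ℤ → Fin 2) → ℤ → ENNReal := fun b m =>
    {b : ℤ → Fin 2 | b 0 = 1 ∧ 0 ≤ m ∧ m < nextOne b 0}.indicator 1 b with hdef
  have hm : ∀ m, Measurable fun b => h b m := fun m =>
    measurable_one.indicator ((measurableSet_site 0 1).inter ((MeasurableSet.const _).inter
      (measurableSet_lt measurable_const (measurable_nextOne 0))))
  have h1 : ∀ b, ∑' m : ℤ, h b m =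
      {b : ℤ → Fin 2 | b 0 = 1}.indicator (fun b => ENNReal.ofReal (nextOne b 0)) b := by
    intro b
    by_cases hb : b 0 = 1
    · rw [tsum_eq_sum (s := Finset.Ico 0 (nextOne b 0))]
      · have : ∀ m ∈ Finset.Ico 0 (nextOne b 0), h b m = 1 := fun m hm => by
          rw [Finset.mem_Ico] at hm
          simp [hdef, hb, hm.1, hm.2]
        rw [Finset.sum_congr rfl this, Set.indicator_of_mem (by exact hb)]
        simp only [Finset.sum_const, Int.card_Ico, sub_zero, nsmul_eq_mul, mul_one]
        rw [← ENNReal.ofReal_natCast]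
        congr 1
      · intro m hm
        rw [Finset.mem_Ico] at hm
        simp only [hdef]
        exact Set.indicator_of_notMem (fun h => hm h.2) _
    · rw [Set.indicator_of_notMem (by exact hb)]
      simp [hdef, hb]
  have h2 : ∀ b, IsRich b → ∑' m : ℤ, h (fun i => b (-m + i)) m = 1 := by
    intro b hb
    rw [tsum_eq_single (-prevOne b 1)]
    · have hp := prevOne_lt b 1
      have hn : 0 < nextOne b (prevOne b 1) := by
        by_contra! hle
        exact ne_one_of_prevOne_lt (lt_nextOne b (prevOne b 1)) (by omega) (hb.nextOne_eq_one _)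
      simp only [hdef]
      rw [Set.indicator_of_mem, Pi.one_apply]
      refine ⟨?_, by omega, ?_⟩
      · simpa using hb.prevOne_eq_one 1
      · rw [nextOne_shift_neg, neg_neg]
        omega
    · intro m hm
      simp only [hdef]
      refine Set.indicator_of_notMem ?_ _
      rintro ⟨h0, hm0, hlt⟩
      rw [nextOne_shift_neg] at hlt
      apply hm
      rw [prevOne_eq_of_forall (m := -m) (by omega) (by simpa using h0) fun k hk hk' =>
        ne_one_of_lt_nextOne hk (by omega), neg_neg]
  have key := lintegral_tsum_shift hν hm
  simp_rw [h1] at key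
  rw [lintegral_indicator (measurableSet_site 0 1)] at key
  rw [key, lintegral_congr_ae (hrich.mono h2)]
  simp

/-- The law seen from a particle is invariant under moving to the next particle. -/
theorem lintegral_shift_nextOne (hν : IsMarkovMeasure (latticeMatrix d) ν)
    (hrich : ∀ᵐ b ∂ν, IsRich b) {g : (ℤ → Fin 2) → ENNReal} (hg : Measurable g) :
    ∫⁻ b in {b | b 0 = 1}, g (fun i => b (nextOne b 0 + i)) ∂ν = ∫⁻ b in {b | b 0 = 1}, g b ∂ν := by
  classical
  -- Every particle sends to the next one the value of `g` seen from there.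
  set h : (ℤ → Fin 2) → ℤ → ENNReal := fun b m =>
    {b : ℤ → Fin 2 | b 0 = 1 ∧ nextOne b 0 = m}.indicator (fun b => g fun i => b (m + i)) b
    with hdef
  have hm : ∀ m, Measurable fun b => h b m := fun m =>
    (hg.comp (measurePreserving_shift hν m).measurable).indicator ((measurableSet_site 0 1).inter
      (measurableSet_eq_fun (measurable_nextOne 0) measurable_const))
  have h1 : ∀ b, ∑' m : ℤ, h b m = {b : ℤ → Fin 2 | b 0 = 1}.indicator
      (fun b => g fun i => b (nextOne b 0 + i)) b := by
    intro b
    rw [tsum_eq_single (nextOne b 0)]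
    · by_cases hb : b 0 = 1 <;> simp [hdef, hb]
    · intro m hm
      simp only [hdef]
      exact Set.indicator_of_notMem (fun h => hm h.2.symm) _
  have h2 : ∀ b, IsRich b → ∑' m : ℤ, h (fun i => b (-m + i)) m =
      {b : ℤ → Fin 2 | b 0 = 1}.indicator g b := by
    intro b hb
    rw [tsum_eq_single (-prevOne b 0)]
    · by_cases h0 : b 0 = 1
      · rw [Set.indicator_of_mem (by exact h0)]
        simp only [hdef]
        rw [Set.indicator_of_mem]
        · simp
        · refine ⟨by simpa using hb.prevOne_eq_one 0, ?_⟩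
          rw [nextOne_shift_neg, neg_neg, nextOne_prevOne h0, add_zero]
      · rw [Set.indicator_of_notMem (by exact h0)]
        simp only [hdef]
        refine Set.indicator_of_notMem ?_ _
        rintro ⟨-, h⟩
        rw [nextOne_shift_neg, neg_neg] at h
        have h' := hb.nextOne_eq_one (prevOne b 0)
        rw [show nextOne b (prevOne b 0) = 0 by omega] at h'
        exact h0 h'
    · intro m hm
      simp only [hdef]
      refine Set.indicator_of_notMem ?_ _
      rintro ⟨h0, h⟩
      rw [nextOne_shift_neg] at h
      have h' : b (-m) = 1 := by simpa using h0
      apply hm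
      rw [← show nextOne b (-m) = 0 by omega, prevOne_nextOne h', neg_neg]
  have key := lintegral_tsum_shift hν hm
  simp_rw [h1] at key
  rw [lintegral_indicator (measurableSet_site 0 1)] at key
  rw [key, lintegral_congr_ae (hrich.mono h2), lintegral_indicator (measurableSet_site 0 1)]

end LatticeMassTransport

/-! ### Symmetries and sizes of the labelled measure -/

section LabelledMeasure

variable {v : ℝ} (hv : 0 < v) (r : ℝ) {d : ℝ} {ν : Measure (ℤ → Fin 2)}

theorem measurable_lintegral_placed {f : LabelledConfig r → ENNReal} (hf : Measurable f) :
    Measurable fun b : ℤ → Fin 2 => ∫⁻ z, f (placed hv r b z) :=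
  (hf.comp (measurable_placed hv r)).lintegral_prod_right'

/-- A measurable property holds almost everywhere if it holds, wherever the particle `0` is placed,
for almost every binary sequence with a one at the origin. -/
theorem ae_labelledMeasure (hν : IsMarkovMeasure (latticeMatrix d) ν) {p : LabelledConfig r → Prop}
    (hp : MeasurableSet {x | p x}) (h : ∀ᵐ b ∂ν, b 0 = 1 → ∀ z, p (placed hv r b z)) :
    ∀ᵐ x ∂labelledMeasure hv r ν, p x := by
  have hc : MeasurableSet {x | p x}ᶜ := hp.compl
  rw [ae_iff]
  change labelledMeasure hv r ν {x | p x}ᶜ = 0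
  rw [← lintegral_indicator_one hc,
    lintegral_labelledMeasure hv r hν (measurable_one.indicator hc)]
  have : ∀ᵐ b ∂ν.restrict {b | b 0 = 1},
      ∫⁻ z, ({x | p x}ᶜ).indicator (1 : LabelledConfig r → ENNReal) (placed hv r b z) = 0 := by
    rw [ae_restrict_iff' (measurableSet_site 0 1)]
    filter_upwards [h] with b hb h0
    simp [hb h0]
  rw [lintegral_congr_ae this]
  simp

theorem translate_placed (s : ℝ) (b : ℤ → Fin 2) (z : ℝ) :
    translate s (placed hv r b z) = placed hv r b (z + s) :=
  Subtype.ext (funext fun i => by simp only [translate, placed]; ring)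

theorem measurePreserving_translate (hν : IsMarkovMeasure (latticeMatrix d) ν) (s : ℝ) :
    MeasurePreserving (translate s) (labelledMeasure hv r ν) (labelledMeasure hv r ν) := by
  refine ⟨measurable_translate s, Measure.ext_of_lintegral _ fun f hf => ?_⟩
  have hf' : Measurable fun x => f (translate s x) := hf.comp (measurable_translate s)
  rw [lintegral_map hf (measurable_translate s), lintegral_labelledMeasure hv r hν hf,
    lintegral_labelledMeasure hv r hν hf']
  congr 1
  refine lintegral_congr fun b => ?_
  simp only [translate_placed]
  exact lintegral_add_right_eq_self (fun z => f (placed hv r b z)) s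

theorem relabel_one_placed {b : ℤ → Fin 2} (hb : IsRich b) (h0 : b 0 = 1) (z : ℝ) :
    relabel 1 (placed hv r b z) = placed hv r (fun i => b (nextOne b 0 + i))
      (z + (v * (nextOne b 0 - 1) + 2 * r)) := by
  refine Subtype.ext (funext fun i => ?_)
  have h1 := onePosition_shift b (nextOne b 0) 0 i
  rw [add_zero, hb.onePosition_nextOne h0] at h1
  simp only [relabel, placed, ← h1]
  push_cast
  ring

theorem measurePreserving_relabel_one (hν : IsMarkovMeasure (latticeMatrix d) ν)
    (hrich : ∀ᵐ b ∂ν, IsRich b) :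
    MeasurePreserving (relabel 1) (labelledMeasure hv r ν) (labelledMeasure hv r ν) := by
  refine ⟨measurable_relabel 1, Measure.ext_of_lintegral _ fun f hf => ?_⟩
  have hf' : Measurable fun x => f (relabel 1 x) := hf.comp (measurable_relabel 1)
  rw [lintegral_map hf (measurable_relabel 1), lintegral_labelledMeasure hv r hν hf,
    lintegral_labelledMeasure hv r hν hf',
    ← lintegral_shift_nextOne hν hrich (measurable_lintegral_placed hv r hf)]
  congr 1
  refine lintegral_congr_ae ?_
  rw [Filter.EventuallyEq, ae_restrict_iff' (measurableSet_site 0 1)]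
  filter_upwards [hrich] with b hb h0
  simp only [relabel_one_placed hv r hb h0]
  exact lintegral_add_right_eq_self
    (fun z => f (placed hv r (fun i => b (nextOne b 0 + i)) z)) _

theorem measurePreserving_relabel (hν : IsMarkovMeasure (latticeMatrix d) ν)
    (hrich : ∀ᵐ b ∂ν, IsRich b) (k : ℤ) :
    MeasurePreserving (relabel k) (labelledMeasure hv r ν) (labelledMeasure hv r ν) := by
  have h1 := measurePreserving_relabel_one hv r hν hrich
  have hcomp : ∀ (k l : ℤ), relabel k ∘ relabel l = relabel (r := r) (k + l) := fun k l => by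
    funext x
    refine Subtype.ext (funext fun i => ?_)
    simp only [relabel, Function.comp, add_assoc]
  have h0 : relabel (r := r) 0 = id := by
    funext x
    exact Subtype.ext (funext fun i => by simp [relabel])
  have hinv : MeasurePreserving (relabel (-1)) (labelledMeasure hv r ν)
      (labelledMeasure hv r ν) := by
    refine ⟨measurable_relabel _, ?_⟩
    conv_lhs => rw [← h1.map_eq, Measure.map_map (measurable_relabel _) (measurable_relabel _)]
    rw [hcomp, neg_add_cancel, h0, Measure.map_id]
  induction k with
  | zero => rw [h0]; exact MeasurePreserving.id _
  | succ k ih => rw [← hcomp]; exact ih.comp h1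
  | pred k ih => rw [sub_eq_add_neg, ← hcomp]; exact ih.comp hinv

/-- The intensity of the particle `0`. -/
theorem labelledMeasure_position_zero (hd0 : 0 < d) (hd1 : d ≤ 1)
    (hν : IsMarkovMeasure (latticeMatrix d) ν) {B : Set ℝ} (hB : MeasurableSet B) :
    labelledMeasure hv r ν {x | x.1 0 ∈ B} = ENNReal.ofReal (d / v) * volume B := by
  have hm : MeasurableSet {x : LabelledConfig r | x.1 0 ∈ B} := measurable_position 0 hB
  rw [← lintegral_indicator_one hm, lintegral_labelledMeasure hv r hν (measurable_one.indicator hm)]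
  have : ∀ b : ℤ → Fin 2, ∫⁻ z, {x : LabelledConfig r | x.1 0 ∈ B}.indicator 1 (placed hv r b z) =
      volume B := by
    intro b
    rw [← lintegral_indicator_one hB]
    refine lintegral_congr fun z => ?_
    by_cases hz : z ∈ B
    · rw [Set.indicator_of_mem (by simpa [placed_zero] using hz), Set.indicator_of_mem hz]
      rfl
    · rw [Set.indicator_of_notMem (by simpa [placed_zero] using hz), Set.indicator_of_notMem hz]
  simp_rw [this]
  rw [lintegral_const, Measure.restrict_apply_univ, measure_one hd0 hd1 hν,
    ENNReal.ofReal_div_of_pos hv, div_eq_mul_inv]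
  ring

/-- The mass of the labelled configurations for which `0` is the label of the last particle at or to
the left of the origin is the mean gap, which Kac's formula gives. -/
theorem labelledMeasure_straddle (hr : 0 ≤ r) (hd0 : 0 < d) (hd1 : d ≤ 1)
    (hν : IsMarkovMeasure (latticeMatrix d) ν) (hrich : ∀ᵐ b ∂ν, IsRich b) :
    labelledMeasure hv r ν {x | x.1 0 ≤ 0 ∧ 0 < x.1 1} =
      ENNReal.ofReal ((v + 2 * r * d - v * d) / v) := by
  have := hν.isProbabilityMeasure
  have hm : MeasurableSet {x : LabelledConfig r | x.1 0 ≤ 0 ∧ 0 < x.1 1} :=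
    (measurableSet_le (measurable_position 0) measurable_const).inter
      (measurableSet_lt measurable_const (measurable_position 1))
  have hnext : Measurable fun b : ℤ → Fin 2 => (nextOne b 0 : ℝ) :=
    (measurable_of_countable fun k : ℤ => (k : ℝ)).comp (measurable_nextOne 0)
  rw [← lintegral_indicator_one hm, lintegral_labelledMeasure hv r hν (measurable_one.indicator hm)]
  have h1 : ∀ b : ℤ → Fin 2, ∫⁻ z, {x : LabelledConfig r | x.1 0 ≤ 0 ∧ 0 < x.1 1}.indicator 1
      (placed hv r b z) = ENNReal.ofReal (v * (nextOne b 0 - 1) + 2 * r) := by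
    intro b
    have e : ∀ z, {x : LabelledConfig r | x.1 0 ≤ 0 ∧ 0 < x.1 1}.indicator
        (1 : LabelledConfig r → ENNReal) (placed hv r b z) =
        (Set.Ioc (-(v * (nextOne b 0 - 1) + 2 * r)) 0).indicator 1 z := by
      intro z
      simp only [Set.indicator, Set.mem_ofPred_eq, placed_zero, placed_one, Set.mem_Ioc,
        neg_lt_iff_pos_add', and_comm, Pi.one_apply]
    simp_rw [e]
    rw [lintegral_indicator_one measurableSet_Ioc, Real.volume_Ioc]
    simp
  simp_rw [h1]
  -- The mean gap is computed after adding the constant `v`, which makes all terms non-negative.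
  have h2 : ∫⁻ b in {b | b 0 = 1}, ENNReal.ofReal (v * (nextOne b 0 - 1) + 2 * r) ∂ν +
      ENNReal.ofReal (v * d) = ENNReal.ofReal (v + 2 * r * d) := by
    have e1 : ENNReal.ofReal (v * d) = ∫⁻ _ in {b : ℤ → Fin 2 | b 0 = 1}, ENNReal.ofReal v ∂ν := by
      rw [lintegral_const, Measure.restrict_apply_univ, measure_one hd0 hd1 hν,
        ENNReal.ofReal_mul hv.le]
    have e2 : ENNReal.ofReal (v + 2 * r * d) = ∫⁻ b in {b : ℤ → Fin 2 | b 0 = 1},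
        (ENNReal.ofReal v * ENNReal.ofReal (nextOne b 0) + ENNReal.ofReal (2 * r)) ∂ν := by
      rw [lintegral_add_right _ measurable_const, lintegral_const_mul _ hnext.ennreal_ofReal,
        lintegral_nextOne hν hrich, lintegral_const, Measure.restrict_apply_univ,
        measure_one hd0 hd1 hν, ← ENNReal.ofReal_mul (by positivity), mul_one,
        ENNReal.ofReal_add hv.le (by positivity)]
    rw [e1, e2, ← lintegral_add_right _ measurable_const]
    refine lintegral_congr fun b => ?_
    have hn : (1 : ℝ) ≤ nextOne b 0 := by exact_mod_cast lt_nextOne b 0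
    have hn' : 0 ≤ v * ((nextOne b 0 : ℝ) - 1) := mul_nonneg hv.le (by linarith)
    rw [← ENNReal.ofReal_mul hv.le, ← ENNReal.ofReal_add (by positivity) hv.le,
      ← ENNReal.ofReal_add (by positivity) (by positivity)]
    congr 1
    ring
  have h3 : ∫⁻ b in {b | b 0 = 1}, ENNReal.ofReal (v * (nextOne b 0 - 1) + 2 * r) ∂ν =
      ENNReal.ofReal (v + 2 * r * d - v * d) := by
    rw [ENNReal.ofReal_sub _ (by positivity), ← h2,
      ENNReal.add_sub_cancel_right ENNReal.ofReal_ne_top]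
  rw [h3, ENNReal.ofReal_div_of_pos hv, div_eq_mul_inv, mul_comm]

/-- The positions of the particles grow linearly, with mean gap `ℓ`, in both directions. -/
def HasMeanGap {r : ℝ} (x : LabelledConfig r) (ℓ : ℝ) : Prop :=
  Tendsto (fun i : ℤ => x.1 i / i) atTop (𝓝 ℓ) ∧ Tendsto (fun i : ℤ => x.1 i / i) atBot (𝓝 ℓ)

theorem measurableSet_hasMeanGap (ℓ : ℝ) :
    MeasurableSet {x : LabelledConfig r | HasMeanGap x ℓ} :=
  (measurableSet_tendsto_fun (fun i => (measurable_position i).div_const _) measurable_const).inter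
    (measurableSet_tendsto_fun (fun i => (measurable_position i).div_const _) measurable_const)

theorem hasMeanGap_placed {b : ℤ → Fin 2} (hb : HasLatticeDensity b d) (hd : 0 < d) (h0 : b 0 = 1)
    (z : ℝ) : HasMeanGap (placed hv r b z) (v * (d⁻¹ - 1) + 2 * r) := by
  have key : ∀ l : Filter ℤ, Tendsto (fun i : ℤ => (onePosition b 0 i : ℝ) / i) l (𝓝 d⁻¹) →
      Tendsto (fun i : ℤ => z / (i : ℝ)) l (𝓝 0) → (∀ᶠ i in l, i ≠ 0) →
      Tendsto (fun i : ℤ => (placed hv r b z).1 i / i) l (𝓝 (v * (d⁻¹ - 1) + 2 * r)) := by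
    intro l h1 h2 h3
    have := (((h1.sub_const 1).const_mul v).add_const (2 * r)).add h2
    rw [add_zero] at this
    refine this.congr' ?_
    filter_upwards [h3] with i hi
    have hi' : (i : ℝ) ≠ 0 := by exact_mod_cast hi
    simp only [placed]
    field_simp
  obtain ⟨h1, h2⟩ := hb.tendsto_onePosition hd h0
  exact ⟨key _ h1 (tendsto_const_nhds.div_atTop tendsto_intCast_atTop_atTop)
    (eventually_ne_atTop 0), key _ h2 (tendsto_const_nhds.div_atBot
      (tendsto_intCast_atBot_iff.2 tendsto_id)) (eventually_ne_atBot 0)⟩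

theorem ae_hasMeanGap (hd0 : 0 < d) (hν : IsMarkovMeasure (latticeMatrix d) ν)
    (hdens : ∀ᵐ b ∂ν, HasLatticeDensity b d) :
    ∀ᵐ x ∂labelledMeasure hv r ν, HasMeanGap x (v * (d⁻¹ - 1) + 2 * r) :=
  ae_labelledMeasure hv r hν (measurableSet_hasMeanGap r _) (hdens.mono fun _ hb h0 =>
    hasMeanGap_placed hv r hb hd0 h0)

/-- On almost every configuration the traffic map is a translation up to a relabelling: if `d ≤ 1/2`
all gaps are at least `v` and every particle moves by `v`; if `d > 1/2` all gaps are at most `v` and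
every particle moves up to the next one. -/
theorem exists_labelledMap_eq_translate (hν : IsMarkovMeasure (latticeMatrix d) ν)
    (hrich : ∀ᵐ b ∂ν, IsRich b) : ∃ s : ℝ, ∀ᵐ x ∂labelledMeasure hv r ν,
      forget (labelledMap hv r x) = forget (translate s x) := by
  have hgap : ∀ (b : ℤ → Fin 2) (z : ℝ) (i : ℤ), (placed hv r b z).1 (i + 1) - 2 * r =
      (placed hv r b z).1 i + v * ((onePosition b 0 (i + 1) - onePosition b 0 i - 1 : ℤ) : ℝ) := by
    intro b z i
    simp only [placed]
    push_cast
    ring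
  by_cases hd : d ≤ 1 / 2
  · refine ⟨v, ?_⟩
    have : ∀ᵐ x ∂labelledMeasure hv r ν,
        ∀ i, min (x.1 i + v) (x.1 (i + 1) - 2 * r) = x.1 i + v := by
      refine ae_labelledMeasure hv r hν ?_ ?_
      · simp only [Set.ofPred_forall]
        exact MeasurableSet.iInter fun i => measurableSet_eq_fun
          (((measurable_position i).add_const v).min ((measurable_position (i + 1)).sub_const _))
          ((measurable_position i).add_const v)
      · filter_upwards [hrich, ae_no_adjacent_ones hν hd] with b hb hno h0 z i
        rw [hgap]
        refine min_eq_left ?_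
        have h1 := lt_nextOne b (onePosition b 0 i)
        rw [← hb.onePosition_succ h0] at h1
        have h2 : onePosition b 0 (i + 1) ≠ onePosition b 0 i + 1 := fun h =>
          hno _ ⟨hb.onePosition_eq_one h0 i, h ▸ hb.onePosition_eq_one h0 (i + 1)⟩
        have h3 : (1 : ℝ) ≤ ((onePosition b 0 (i + 1) - onePosition b 0 i - 1 : ℤ) : ℝ) := by
          exact_mod_cast (by omega : (1 : ℤ) ≤ onePosition b 0 (i + 1) - onePosition b 0 i - 1)
        nlinarith
    filter_upwards [this] with x hx
    congr 1
    exact Subtype.ext (funext hx)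
  · refine ⟨-(2 * r), ?_⟩
    have : ∀ᵐ x ∂labelledMeasure hv r ν,
        ∀ i, min (x.1 i + v) (x.1 (i + 1) - 2 * r) = x.1 (i + 1) - 2 * r := by
      refine ae_labelledMeasure hv r hν ?_ ?_
      · simp only [Set.ofPred_forall]
        exact MeasurableSet.iInter fun i => measurableSet_eq_fun
          (((measurable_position i).add_const v).min ((measurable_position (i + 1)).sub_const _))
          ((measurable_position (i + 1)).sub_const _)
      · filter_upwards [hrich, ae_no_adjacent_zeros hν hd] with b hb hno h0 z i
        refine min_eq_right ?_
        rw [hgap]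
        have h1 : onePosition b 0 (i + 1) ≤ onePosition b 0 i + 2 := by
          rw [hb.onePosition_succ h0]
          set n := onePosition b 0 i
          by_contra! h
          have e1 := ne_one_of_lt_nextOne (b := b) (n := n) (m := n + 1) (by omega) (by omega)
          have e2 := ne_one_of_lt_nextOne (b := b) (n := n) (m := n + 1 + 1) (by omega) (by omega)
          exact hno (n + 1) ⟨(fin_two_cases _).resolve_right e1, (fin_two_cases _).resolve_right e2⟩
        have h3 : ((onePosition b 0 (i + 1) - onePosition b 0 i - 1 : ℤ) : ℝ) ≤ 1 := by
          exact_mod_cast (by omega : onePosition b 0 (i + 1) - onePosition b 0 i - 1 ≤ (1 : ℤ))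
        nlinarith
    filter_upwards [this] with x hx
    rw [← forget_relabel 1 (translate _ x)]
    congr 1
    exact Subtype.ext (funext fun i => (hx i).trans (sub_eq_add_neg _ _))

end LabelledMeasure

/-! ### Forgetting the labels of a stationary labelled process -/

/-- A measure on labelled configurations that is invariant under translations and under
relabellings, with mean gap `ℓ`, for which the particle `0` has the intensity `C`. -/
structure IsStationaryLabelled {r : ℝ} (L : Measure (LabelledConfig r)) (ℓ C : ℝ) : Prop where
  translate_invariant : ∀ s, MeasurePreserving (translate s) L L
  relabel_invariant : ∀ k, MeasurePreserving (relabel k) L L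
  meanGap : ∀ᵐ x ∂L, HasMeanGap x ℓ
  intensity : ∀ B : Set ℝ, MeasurableSet B → L {x | x.1 0 ∈ B} = ENNReal.ofReal C * volume B

/-- The labelled configurations in which `0` is the label of the last particle at or to the left of
the origin. -/
def straddling (r : ℝ) : Set (LabelledConfig r) := {x | x.1 0 ≤ 0 ∧ 0 < x.1 1}

section Straddling

variable {r : ℝ} {ℓ : ℝ}

theorem measurableSet_straddling : MeasurableSet (straddling r) :=
  (measurableSet_le (measurable_position 0) measurable_const).inter
    (measurableSet_lt measurable_const (measurable_position 1))

theorem relabel_mem_straddling_iff {k : ℤ} {x : LabelledConfig r} :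
    relabel k x ∈ straddling r ↔ x.1 k ≤ 0 ∧ 0 < x.1 (k + 1) := by
  have : (relabel k x).1 0 = x.1 k := by simp [relabel]
  have h : (relabel k x).1 1 = x.1 (k + 1) := by simp [relabel, add_comm]
  simp only [straddling, Set.mem_ofPred_eq, this, h]

theorem straddling_label_unique (hr : 0 ≤ r) {x : LabelledConfig r} {k l : ℤ}
    (hk : relabel k x ∈ straddling r) (hl : relabel l x ∈ straddling r) : k = l := by
  rw [relabel_mem_straddling_iff] at hk hl
  have hm := position_monotone hr x
  by_contra hne
  rcases lt_or_gt_of_ne hne with h | h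
  · linarith [hm (show k + 1 ≤ l by omega)]
  · linarith [hm (show l + 1 ≤ k by omega)]

theorem HasMeanGap.exists_straddling {x : LabelledConfig r} (hx : HasMeanGap x ℓ)
    (hℓ : 0 < ℓ) : ∃ k : ℤ, relabel k x ∈ straddling r := by
  have h1 : Tendsto x.1 atTop atTop := by
    refine (hx.1.pos_mul_atTop hℓ (tendsto_intCast_atTop_atTop (R := ℝ))).congr' ?_
    filter_upwards [eventually_ne_atTop 0] with i hi
    have hi' : (i : ℝ) ≠ 0 := by exact_mod_cast hi
    field_simp
  have h2 : Tendsto x.1 atBot atBot := by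
    refine (hx.2.pos_mul_atBot hℓ ((tendsto_intCast_atBot_iff (R := ℝ)).2 tendsto_id)).congr' ?_
    filter_upwards [eventually_ne_atBot 0] with i hi
    have hi' : (i : ℝ) ≠ 0 := by exact_mod_cast hi
    simp only [id]
    field_simp
  obtain ⟨N, hN⟩ := eventually_atTop.1 (h1.eventually_gt_atTop 0)
  obtain ⟨M, hM⟩ := (h2.eventually_le_atBot 0).exists
  obtain ⟨k, hk, hmax⟩ := Int.exists_greatest_of_bdd (P := fun k => x.1 k ≤ 0)
    ⟨N, fun z hz => by
      by_contra! h
      exact (hN z h.le).not_ge hz⟩ ⟨M, hM⟩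
  refine ⟨k, relabel_mem_straddling_iff.2 ⟨hk, ?_⟩⟩
  by_contra! h
  have := hmax _ h
  omega

theorem HasMeanGap.tsum_straddling (hr : 0 ≤ r) {x : LabelledConfig r} (hx : HasMeanGap x ℓ)
    (hℓ : 0 < ℓ) :
    ∑' k : ℤ, (straddling r).indicator (1 : LabelledConfig r → ENNReal) (relabel k x) = 1 := by
  obtain ⟨k, hk⟩ := hx.exists_straddling hℓ
  rw [tsum_eq_single k, Set.indicator_of_mem hk, Pi.one_apply]
  intro l hl
  exact Set.indicator_of_notMem (fun h => hl (straddling_label_unique hr h hk)) _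

theorem relabel_relabel (k l : ℤ) (x : LabelledConfig r) :
    relabel k (relabel l x) = relabel (k + l) x :=
  Subtype.ext (funext fun i => by simp only [relabel, add_assoc])

theorem relabel_zero (x : LabelledConfig r) : relabel 0 x = x :=
  Subtype.ext (funext fun i => by simp [relabel])

theorem translate_translate (s t : ℝ) (x : LabelledConfig r) :
    translate s (translate t x) = translate (t + s) x :=
  Subtype.ext (funext fun i => by simp only [translate, add_assoc])

theorem translate_zero (x : LabelledConfig r) : translate 0 x = x :=
  Subtype.ext (funext fun i => by simp [translate])

theorem relabel_translate (k : ℤ) (s : ℝ) (x : LabelledConfig r) :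
    relabel k (translate s x) = translate s (relabel k x) := rfl

theorem exists_relabel_eq {x y : LabelledConfig r} (h : forget y = forget x) :
    ∃ k : ℤ, y = relabel k x := by
  obtain ⟨k, hk⟩ : ∃ k : ℤ, ∀ i, y.1 i = x.1 (i + k) := Quotient.exact h.symm
  exact ⟨k, Subtype.ext (funext hk)⟩

theorem HasMeanGap.translate_config {x : LabelledConfig r} (hx : HasMeanGap x ℓ) (s : ℝ) :
    HasMeanGap (translate s x) ℓ := by
  have h1 := hx.1.add (tendsto_const_nhds.div_atTop (tendsto_intCast_atTop_atTop (R := ℝ)) :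
    Tendsto (fun i : ℤ => s / (i : ℝ)) atTop (𝓝 0))
  have h2 := hx.2.add (tendsto_const_nhds.div_atBot
    ((tendsto_intCast_atBot_iff (R := ℝ)).2 tendsto_id) :
    Tendsto (fun i : ℤ => s / (i : ℝ)) atBot (𝓝 0))
  simp only [add_zero, ← add_div] at h1 h2
  exact ⟨h1, h2⟩

end Straddling

section Density

variable {r : ℝ} {ρ : ℝ}

theorem HasMeanGap.tendsto_density {x : LabelledConfig r} (hx : HasMeanGap x ρ⁻¹) (hρ : 0 < ρ)
    (k : ℤ) : Tendsto (fun n : ℕ => (n : ℝ) / (x.1 ((n : ℤ) - 1 + k) - x.1 k)) atTop (𝓝 ρ) := by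
  have hm : Tendsto (fun n : ℕ => (n : ℤ) - 1 + k) atTop atTop :=
    (tendsto_atTop_add_const_right _ (-1 + k) tendsto_natCast_atTop_atTop).congr fun n => by ring
  have h1 := hx.1.comp hm
  have hc : ∀ c : ℝ, Tendsto (fun n : ℕ => c / (n : ℝ)) atTop (𝓝 0) := fun c =>
    tendsto_const_nhds.div_atTop tendsto_natCast_atTop_atTop
  have h2 := (h1.mul ((hc (k - 1)).const_add 1)).sub (hc (x.1 k))
  rw [add_zero, mul_one, sub_zero] at h2
  have h3 := h2.inv₀ (inv_ne_zero hρ.ne')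
  rw [inv_inv] at h3
  refine h3.congr' ?_
  filter_upwards [eventually_gt_atTop 0, hm.eventually_ne_atTop 0] with n hn hn'
  have e1 : (n : ℝ) ≠ 0 := by exact_mod_cast hn.ne'
  have e2 : (n : ℝ) - 1 + k ≠ 0 := by exact_mod_cast hn'
  have e3 : 1 + ((k : ℝ) - 1) / n = ((n : ℝ) - 1 + k) / n := by field_simp; ring
  simp only [Function.comp]
  push_cast
  rw [e3, div_mul_div_cancel₀ e2, ← sub_div, inv_div]

theorem hasDensity_forget_iff {x : LabelledConfig r} : HasDensity (forget x) ρ ↔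
    ∀ k : ℤ, Tendsto (fun n : ℕ => (n : ℝ) / (x.1 ((n : ℤ) - 1 + k) - x.1 k)) atTop (𝓝 ρ) := by
  constructor
  · intro h k
    simpa [relabel] using h (relabel k x) (forget_relabel k x)
  · intro h y hy
    obtain ⟨k, rfl⟩ := exists_relabel_eq hy
    simpa [relabel] using h k

theorem measurableSet_hasDensity : MeasurableSet {c : Config r | HasDensity c ρ} := by
  rw [measurableSet_config_iff]
  have : forget ⁻¹' {c : Config r | HasDensity c ρ} = ⋂ k : ℤ, {x | Tendsto
      (fun n : ℕ => (n : ℝ) / (x.1 ((n : ℤ) - 1 + k) - x.1 k)) atTop (𝓝 ρ)} := by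
    ext x
    simp only [Set.mem_preimage, Set.mem_ofPred_eq, hasDensity_forget_iff, Set.mem_iInter]
  rw [this]
  exact MeasurableSet.iInter fun k => measurableSet_tendsto_fun (fun n =>
    measurable_const.div ((measurable_position _).sub (measurable_position _))) measurable_const

end Density

theorem measurable_count {r : ℝ} {B : Set ℝ} (hB : MeasurableSet B) :
    Measurable (count (r := r) B) := by
  refine measurable_from_quotient.2 ?_
  exact Measurable.tsum fun i => (measurable_one.indicator hB).comp (measurable_position i)

namespace IsStationaryLabelled

variable {r : ℝ} {L : Measure (LabelledConfig r)} {ℓ C : ℝ}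

/-- The mass transport principle for labelled configurations: summing over all labels amounts to
integrating over all labellings of a configuration. -/
theorem lintegral_mul_forget (hL : IsStationaryLabelled L ℓ C) (hr : 0 ≤ r) (hℓ : 0 < ℓ)
    {h : LabelledConfig r → ENNReal} (hh : Measurable h) {f : Config r → ENNReal}
    (hf : Measurable f) : ∫⁻ x, h x * f (forget x) ∂L =
      ∫⁻ x in straddling r, (∑' k : ℤ, h (relabel k x)) * f (forget x) ∂L := by
  set I : LabelledConfig r → ENNReal := (straddling r).indicator 1 with hI
  have mI : Measurable I := measurable_one.indicator measurableSet_straddling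
  have mf : Measurable fun x : LabelledConfig r => f (forget x) := hf.comp measurable_forget
  have mG : ∀ k : ℤ, Measurable fun x => I (relabel k x) * (h x * f (forget x)) := fun k =>
    (mI.comp (measurable_relabel k)).mul (hh.mul mf)
  have mG' : ∀ k : ℤ, Measurable fun x => I x * (h (relabel (-k) x) * f (forget x)) := fun k =>
    mI.mul ((hh.comp (measurable_relabel (-k))).mul mf)
  calc ∫⁻ x, h x * f (forget x) ∂L
      = ∫⁻ x, ∑' k : ℤ, I (relabel k x) * (h x * f (forget x)) ∂L := by
        refine lintegral_congr_ae ?_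
        filter_upwards [hL.meanGap] with x hx
        rw [ENNReal.tsum_mul_right, hx.tsum_straddling hr hℓ, one_mul]
    _ = ∑' k : ℤ, ∫⁻ x, I (relabel k x) * (h x * f (forget x)) ∂L :=
        lintegral_tsum fun k => (mG k).aemeasurable
    _ = ∑' k : ℤ, ∫⁻ x, I x * (h (relabel (-k) x) * f (forget x)) ∂L := by
        refine tsum_congr fun k => ?_
        rw [← (hL.relabel_invariant (-k)).lintegral_comp (mG k)]
        simp only [relabel_relabel, add_neg_cancel, relabel_zero, forget_relabel]
    _ = ∫⁻ x, ∑' k : ℤ, I x * (h (relabel (-k) x) * f (forget x)) ∂L :=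
        (lintegral_tsum fun k => (mG' k).aemeasurable).symm
    _ = ∫⁻ x, (straddling r).indicator
          (fun x => (∑' k : ℤ, h (relabel k x)) * f (forget x)) x ∂L := by
        refine lintegral_congr fun x => ?_
        have hneg : ∑' k : ℤ, h (relabel (-k) x) = ∑' k : ℤ, h (relabel k x) :=
          (Equiv.neg ℤ).tsum_eq fun k => h (relabel k x)
        rw [ENNReal.tsum_mul_left, ENNReal.tsum_mul_right, hneg]
        by_cases hx : x ∈ straddling r <;> simp [hI, hx]
    _ = _ := lintegral_indicator measurableSet_straddling _

/-- The law on unlabelled configurations is invariant under translations. -/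
theorem setLIntegral_forget_translate (hL : IsStationaryLabelled L ℓ C) (hr : 0 ≤ r) (hℓ : 0 < ℓ)
    {f : Config r → ENNReal} (hf : Measurable f) (s : ℝ) :
    ∫⁻ x in straddling r, f (forget (translate s x)) ∂L =
      ∫⁻ x in straddling r, f (forget x) ∂L := by
  set I : LabelledConfig r → ENNReal := (straddling r).indicator 1 with hI
  have mI : Measurable I := measurable_one.indicator measurableSet_straddling
  have mf : Measurable fun x : LabelledConfig r => f (forget x) := hf.comp measurable_forget
  have mh : Measurable fun x => I (translate (-s) x) := mI.comp (measurable_translate (-s))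
  rw [← lintegral_indicator measurableSet_straddling]
  calc ∫⁻ x, (straddling r).indicator (fun x => f (forget (translate s x))) x ∂L
      = ∫⁻ x, I (translate (-s) (translate s x)) *
          f (forget (translate s x)) ∂L := by
        refine lintegral_congr fun x => ?_
        rw [translate_translate, add_neg_cancel, translate_zero]
        by_cases hx : x ∈ straddling r <;> simp [hI, hx]
    _ = ∫⁻ x, I (translate (-s) x) * f (forget x) ∂L :=
        (hL.translate_invariant s).lintegral_comp (mh.mul mf)
    _ = ∫⁻ x in straddling r, (∑' k : ℤ, I (translate (-s) (relabel k x))) *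
          f (forget x) ∂L := hL.lintegral_mul_forget hr hℓ mh hf
    _ = ∫⁻ x in straddling r, f (forget x) ∂L := by
        refine lintegral_congr_ae (ae_restrict_of_ae ?_)
        filter_upwards [hL.meanGap] with x hx
        simp only [← relabel_translate]
        rw [(hx.translate_config (-s)).tsum_straddling hr hℓ, one_mul]

theorem setLIntegral_count (hL : IsStationaryLabelled L ℓ C) (hr : 0 ≤ r) (hℓ : 0 < ℓ)
    {B : Set ℝ} (hB : MeasurableSet B) :
    ∫⁻ x in straddling r, count B (forget x) ∂L = ENNReal.ofReal C * volume B := by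
  have mh : Measurable fun x : LabelledConfig r => B.indicator (1 : ℝ → ENNReal) (x.1 0) :=
    (measurable_one.indicator hB).comp (measurable_position 0)
  have key := hL.lintegral_mul_forget hr hℓ mh (f := fun _ => 1) measurable_const
  simp only [mul_one] at key
  have e : ∀ x : LabelledConfig r, count B (forget x) =
      ∑' k : ℤ, B.indicator (1 : ℝ → ENNReal) ((relabel k x).1 0) := fun x => by
    simp only [relabel, zero_add]
    rfl
  simp_rw [e]
  have mB : MeasurableSet {x : LabelledConfig r | x.1 0 ∈ B} := measurable_position 0 hB
  rw [← key, ← hL.intensity B hB, ← lintegral_indicator_one mB]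
  rfl

/-- The law on unlabelled configurations is non-atomic, because the position of the last particle to
the left of the origin has a bounded density. -/
theorem nonAtomic_map_forget (hL : IsStationaryLabelled L ℓ C) (hr : 0 ≤ r)
    (h0 : L (straddling r) ≠ 0) :
    NonAtomic ((ProbabilityTheory.cond L (straddling r)).map forget) := by
  set μ := (ProbabilityTheory.cond L (straddling r)).map forget with hμ
  have hμA : ∀ A : Set (Config r), MeasurableSet A →
      μ A = (L (straddling r))⁻¹ * L (straddling r ∩ forget ⁻¹' A) := fun A hA => by
    rw [hμ, Measure.map_apply measurable_forget hA,
      ProbabilityTheory.cond_apply measurableSet_straddling]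
  intro A hA hpos
  set K : ENNReal := (L (straddling r))⁻¹ * ENNReal.ofReal C with hK
  have hKtop : K ≠ ⊤ := ENNReal.mul_ne_top (ENNReal.inv_ne_top.2 h0) ENNReal.ofReal_ne_top
  obtain ⟨δ, hδ, hδK⟩ : ∃ δ : ℝ, 0 < δ ∧ K * ENNReal.ofReal δ < μ A := by
    have ht : Tendsto (fun δ : ℝ => K * ENNReal.ofReal δ) (𝓝[>] 0) (𝓝 0) := by
      have h1 : Tendsto (fun δ : ℝ => ENNReal.ofReal δ) (𝓝[>] 0) (𝓝 0) := by
        simpa using (ENNReal.continuous_ofReal.tendsto 0).mono_left nhdsWithin_le_nhds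
      simpa using ENNReal.Tendsto.const_mul h1 (Or.inr hKtop)
    obtain ⟨δ, h1, h2⟩ := ((ht.eventually_lt_const hpos).and self_mem_nhdsWithin).exists
    exact ⟨δ, h2, h1⟩
  set J : ℤ → Set ℝ := fun n => Set.Ico (n • δ) ((n + 1) • δ) with hJ
  -- The configurations whose last particle at or to the left of the origin lies in `J n`.
  set E : ℤ → Set (Config r) := fun n => {c | ∃ x, forget x = c ∧ x ∈ straddling r ∧ x.1 0 ∈ J n}
    with hE
  have preE : ∀ n, forget ⁻¹' E n = ⋃ k : ℤ, relabel k ⁻¹' (straddling r ∩ {x | x.1 0 ∈ J n}) := by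
    intro n
    ext x
    simp only [hE, Set.mem_preimage, Set.mem_ofPred_eq, Set.mem_iUnion, Set.mem_inter_iff]
    constructor
    · rintro ⟨y, hy, h1, h2⟩
      obtain ⟨k, rfl⟩ := exists_relabel_eq hy
      exact ⟨k, h1, h2⟩
    · rintro ⟨k, h1, h2⟩
      exact ⟨relabel k x, forget_relabel k x, h1, h2⟩
  have mE : ∀ n, MeasurableSet (E n) := fun n => by
    rw [measurableSet_config_iff, preE]
    exact MeasurableSet.iUnion fun k => measurable_relabel k
      (measurableSet_straddling.inter (measurable_position 0 measurableSet_Ico))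
  have hEle : ∀ n, μ (E n) ≤ K * ENNReal.ofReal δ := by
    intro n
    rw [hμA _ (mE n), hK, mul_assoc]
    gcongr
    have hvol : volume (J n) = ENNReal.ofReal δ := by
      rw [hJ, Real.volume_Ico, add_smul, one_smul, add_sub_cancel_left]
    rw [← hvol, ← hL.intensity (J n) measurableSet_Ico]
    refine measure_mono ?_
    rintro x ⟨hx, hx'⟩
    rw [preE, Set.mem_iUnion] at hx'
    obtain ⟨k, h1, h2⟩ := hx'
    have : k = 0 := straddling_label_unique hr h1 (by rwa [relabel_zero])
    subst this
    rwa [relabel_zero] at h2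
  have hcover : A ⊆ (⋃ n, A ∩ E n) ∪ (⋃ n, E n)ᶜ := by
    intro c hc
    by_cases h : c ∈ ⋃ n, E n
    · rw [← Set.inter_iUnion]
      exact Or.inl ⟨hc, h⟩
    · exact Or.inr h
  have hnull : μ (⋃ n, E n)ᶜ = 0 := by
    rw [hμA _ (MeasurableSet.iUnion mE).compl]
    have : straddling r ∩ forget ⁻¹' (⋃ n, E n)ᶜ = ∅ := by
      refine Set.eq_empty_of_forall_notMem fun x ⟨hx, hx'⟩ => hx' ?_
      have : x.1 0 ∈ ⋃ n : ℤ, J n := by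
        rw [hJ, iUnion_Ico_zsmul hδ]
        trivial
      obtain ⟨n, hn⟩ := Set.mem_iUnion.1 this
      exact Set.mem_iUnion.2 ⟨n, x, rfl, hx, hn⟩
    rw [this, measure_empty, mul_zero]
  obtain ⟨n, hn⟩ : ∃ n, μ (A ∩ E n) ≠ 0 := by
    by_contra! h
    refine hpos.ne' (measure_mono_null hcover (measure_union_null ?_ hnull))
    exact measure_iUnion_null h
  exact ⟨A ∩ E n, Set.inter_subset_left, hA.inter (mE n), pos_iff_ne_zero.2 hn,
    (measure_mono Set.inter_subset_right).trans_lt ((hEle n).trans_lt hδK)⟩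

theorem measurePreserving_map_forget (hL : IsStationaryLabelled L ℓ C) (hr : 0 ≤ r) (hℓ : 0 < ℓ)
    {T : Config r → Config r} (hT : Measurable T) {s : ℝ}
    (hTs : ∀ᵐ x ∂L, T (forget x) = forget (translate s x)) :
    MeasurePreserving T ((ProbabilityTheory.cond L (straddling r)).map forget)
      ((ProbabilityTheory.cond L (straddling r)).map forget) := by
  refine ⟨hT, Measure.ext_of_lintegral _ fun f hf => ?_⟩
  have hfT : Measurable fun c => f (T c) := hf.comp hT
  rw [lintegral_map hf hT, lintegral_map hfT measurable_forget, lintegral_map hf measurable_forget,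
    ProbabilityTheory.cond, lintegral_smul_measure, lintegral_smul_measure,
    ← hL.setLIntegral_forget_translate hr hℓ hf s]
  congr 1
  refine lintegral_congr_ae (ae_restrict_of_ae ?_)
  filter_upwards [hTs] with x hx
  rw [hx]

theorem ae_hasDensity_map_forget {ρ : ℝ} (hL : IsStationaryLabelled L ρ⁻¹ C) (hρ : 0 < ρ) :
    ∀ᵐ c ∂(ProbabilityTheory.cond L (straddling r)).map forget, HasDensity c ρ := by
  rw [ae_map_iff measurable_forget.aemeasurable measurableSet_hasDensity]
  refine ProbabilityTheory.cond_absolutelyContinuous.ae_le ?_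
  filter_upwards [hL.meanGap] with x hx
  exact hasDensity_forget_iff.2 (hx.tendsto_density hρ)

end IsStationaryLabelled

end Traffic

theorem theoremt (v r ρ : ℝ) (hv : 0 < v) (hr : 0 ≤ r) (hρ : 0 < ρ) (hρr : 2 * r * ρ ≤ 1) :
    ∃ ν : Measure (ℤ → Fin 2),
      Traffic.IsMarkovMeasure (Traffic.latticeMatrix (Traffic.latticeDensity v r ρ)) ν ∧
      ν {b | b 0 = 1} = ENNReal.ofReal (Traffic.latticeDensity v r ρ) ∧
      ∃ μ : Measure (Traffic.Config r),
        μ = Traffic.continuumMeasure hv r ν ∧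
        IsProbabilityMeasure μ ∧
        MeasurePreserving (Traffic.trafficMap hv r) μ μ ∧
        Traffic.NonAtomic μ ∧
        (∀ᵐ c ∂μ, Traffic.HasDensity c ρ) ∧
        ∀ (t : ℕ) (B : Set ℝ), MeasurableSet B →
          ∫⁻ c, Traffic.count B ((Traffic.trafficMap hv r)^[t] c) ∂μ =
            ENNReal.ofReal ρ * volume B := by
  open Traffic in
  have hden : 0 < 1 + v * ρ - 2 * r * ρ := by nlinarith [mul_pos hv hρ]
  have hdeq : latticeDensity v r ρ = v * ρ / (1 + v * ρ - 2 * r * ρ) := by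
    unfold latticeDensity
    congr 1
    field_simp
    ring
  set d := latticeDensity v r ρ with hd
  have hd0 : 0 < d := hdeq ▸ div_pos (mul_pos hv hρ) hden
  have hd1 : d ≤ 1 := by rw [hdeq, div_le_one hden]; linarith
  have hrel : d * (1 + v * ρ - 2 * r * ρ) = v * ρ := by
    rw [hdeq, div_mul_cancel₀ _ hden.ne']
  obtain ⟨ν, hν, hM⟩ := exists_isMarkovMeasure hd0 hd1
  have hdens := ae_hasLatticeDensity hd0 hd1 hν hM
  have hrich : ∀ᵐ b ∂ν, IsRich b := hdens.mono fun b hb => hb.isRich hd0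
  have hℓ : v * (d⁻¹ - 1) + 2 * r = ρ⁻¹ := by
    field_simp
    linarith
  set L := labelledMeasure hv r ν with hLdef
  have hL : IsStationaryLabelled L ρ⁻¹ (d / v) :=
    { translate_invariant := measurePreserving_translate hv r hν
      relabel_invariant := measurePreserving_relabel hv r hν hrich
      meanGap := hℓ ▸ ae_hasMeanGap hv r hd0 hν hdens
      intensity := fun B hB => labelledMeasure_position_zero hv r hd0 hd1 hν hB }
  have hLD : L (straddling r) = ENNReal.ofReal (d / (v * ρ)) := by
    have := labelledMeasure_straddle hv r hr hd0 hd1 hν hrich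
    rw [straddling, hLdef, this]
    congr 1
    field_simp
    linarith
  have hLD0 : L (straddling r) ≠ 0 := by
    rw [hLD, ne_eq, ENNReal.ofReal_eq_zero, not_le]
    positivity
  have hinv : (L (straddling r))⁻¹ * ENNReal.ofReal (d / v) = ENNReal.ofReal ρ := by
    rw [hLD, ← ENNReal.ofReal_inv_of_pos (by positivity), ← ENNReal.ofReal_mul (by positivity)]
    congr 1
    field_simp
  have hℓ0 : 0 < ρ⁻¹ := inv_pos.2 hρ
  obtain ⟨s, hs⟩ := exists_labelledMap_eq_translate hv r hν hrich
  have hT := hL.measurePreserving_map_forget hr hℓ0 (measurable_trafficMap hv) hs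
  have hprob : IsProbabilityMeasure ((ProbabilityTheory.cond L (straddling r)).map forget) := by
    have := ProbabilityTheory.cond_isProbabilityMeasure_of_finite hLD0
      (hLD ▸ ENNReal.ofReal_ne_top : L (straddling r) ≠ ⊤)
    exact Measure.isProbabilityMeasure_map measurable_forget.aemeasurable
  refine ⟨ν, hν, measure_one hd0 hd1 hν 0, _, rfl, hprob, hT, hL.nonAtomic_map_forget hr hLD0,
    hL.ae_hasDensity_map_forget hρ, fun t B hB => ?_⟩
  have h1 := (hT.iterate t).lintegral_comp (measurable_count (r := r) hB)
  refine h1.trans ?_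
  rw [lintegral_map (measurable_count hB) measurable_forget, ProbabilityTheory.cond,
    lintegral_smul_measure, hL.setLIntegral_count hr hℓ0 hB, smul_eq_mul, ← mul_assoc, hinv]
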